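/- Let $\beta>0$, let $\Gamma_\beta=\{e^{2k\pi\beta}:k\in\mathbb Z\}\subset\mathbb C^*$, let $\mathbb E=\mathbb C^*/\Gamma_\beta$ be the corresponding elliptic curve, with projection $w\mapsto[w]$, and let $z$ be the inhomogeneous coordinate on the Riemann sphere $\mathbb P^1$. Let $$\mathbb O=\{(z,[w])\in\mathbb P^1\times\mathbb E:\ \operatorname{Re}(zw)>0\}.$$ Put $\phi=\dfrac{dz}{1+|z|^2}$, let $\psi$ be the holomorphic $1$-form on $\mathbb E$ whose pullback to $\mathbb C^*$ is $\dfrac{dw}{w}$, and give $\mathbb O$ the restriction of the Hermitian metric $\phi\otimes\overline\phi+\psi\otimes\overline\psi$ of $\mathbb P^1\times\mathbb E$ (so that $\phi,\psi$ is a unitary coframe). Let $L^2_{p,q}(\mathbb O)$ be the Hilbert space of square-integrable $(p,q)$-forms on $\mathbb O$ for this metric, and let $\overline\partial:L^2_{2,0}(\mathbb O)\dashrightarrow L^2_{2,1}(\mathbb O)$ be the maximal realization of the Cauchy--Riemann operator: its domain consists of all $f\in L^2_{2,0}(\mathbb O)$ whose $\overline\partial f$, taken in the sense of distributions, lies in $L^2_{2,1}(\mathbb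 O)$. Let $L^2_{2,0}(\mathbb O,z\text{-only})$ be the space of all forms $u\,dz\wedge\psi$ in $L^2_{2,0}(\mathbb O)$ whose coefficient $u$ is a function of $z$ alone, and let $L^2_{2,1}(\mathbb O,z\text{-only})$ be the space of all forms $v\,d\overline z\wedge dz\wedge\psi$ in $L^2_{2,1}(\mathbb O)$ whose coefficient $v$ is a function of $z$ alone. Then the restriction of $\overline\partial$ to the forms of its domain that lie in $L^2_{2,0}(\mathbb O,z\text{-only})$ has closed range in $L^2_{2,1}(\mathbb O)$. Moreover, $L^2_{2,1}(\mathbb O,z\text{-only})$ is a closed subspace of $L^2_{2,1}(\mathbb O)$ that contains the form $\overline\phi\wedge\phi\wedge\psi$, and the range is the orthogonal complement of $\overline\phi\wedge\phi\wedge\psi$ in this subspace, that is, $$\overline\partial\bigl(\operatorname{Dom}(\overline\partial)\cap L^2_{2,0}(\mathbb O,z\text{-only})\bigr)=\bigl\{g\in L^2_{2,1}(\mathbb O,z\text{-only}):\ \langle g,\overline\phi\wedge\phi\wedge\psi\rangle_{L^2_{2,1}(\mathbb O)}=0\bigr\}.$$ -/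

import Mathlib

open MeasureTheory Complex
open scoped ContDiff ComplexConjugate InnerProductSpace

namespace OhsawaDomain

noncomputable section

/-! ### Exterior algebra of a complex two-dimensional tangent space

A tangent vector is written as the pair `(φ v, ψ v) : ℂ × ℂ` of its components with respect to
a unitary coframe `φ, ψ` of `(1,0)`-covectors. -/

/-- Complex valued real-linear covectors on `ℂ × ℂ`. -/
abbrev Covector : Type := (ℂ × ℂ) →ₗ[ℝ] ℂ

/-- The wedge product `θ 0 ∧ ⋯ ∧ θ (k-1)` of covectors, `(v₀, …) ↦ det (θ j (v i))`. -/
def wedge {k : ℕ} (θ : Fin k → Covector) : (ℂ × ℂ) [⋀^Fin k]→ₗ[ℝ] ℂ :=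
  { ((Matrix.detRowAlternating (R := ℂ) (n := Fin k)).toMultilinearMap.restrictScalars
      ℝ).compLinearMap (fun _ => LinearMap.pi θ) with
    map_eq_zero_of_eq' := by
      intro v i j h hij
      refine (Matrix.detRowAlternating (R := ℂ) (n := Fin k)).map_eq_zero_of_eq
        (fun i => LinearMap.pi θ (v i)) (i := i) (j := j) ?_ hij
      simp only [h] }

lemma wedge_apply {k : ℕ} (θ : Fin k → Covector) (v : Fin k → ℂ × ℂ) :
    wedge θ v = Matrix.det (Matrix.of fun i j => θ j (v i)) := rfl

/-- The covector `φ`. -/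
def phi : Covector := LinearMap.fst ℝ ℂ ℂ

/-- The covector `ψ`. -/
def psi : Covector := LinearMap.snd ℝ ℂ ℂ

/-- The complex conjugate of a covector. -/
def conjCov (θ : Covector) : Covector := conjAe.toLinearMap ∘ₗ θ

/-- The covector `dz = (1 + |z|²) φ` at a point with first coordinate `z`. -/
def dzAt (z : ℂ) : Covector := ((1 + ‖z‖ ^ 2 : ℝ) : ℂ) • phi

/-- The space of covectors of bidegree `(p,q)`: the alternating real-multilinear `(p+q)`-forms
`α` with `α (c v₁, …, c vₖ) = c ^ p * (conj c) ^ q * α (v₁, …, vₖ)` for all complex `c`. -/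
def formsOfType (p q : ℕ) : Submodule ℂ ((ℂ × ℂ) [⋀^Fin (p + q)]→ₗ[ℝ] ℂ) where
  carrier := {α | ∀ (c : ℂ) (v : Fin (p + q) → ℂ × ℂ),
    α (fun i => c • v i) = c ^ p * (conj c) ^ q * α v}
  zero_mem' := by intro c v; simp
  add_mem' := by
    intro α α' h h' c v
    simp only [AlternatingMap.add_apply, h c v, h' c v]; ring
  smul_mem' := by
    intro a α h c v
    simp only [AlternatingMap.smul_apply, h c v, smul_eq_mul]; ring

/-- The real basis `(1,0), (i,0), (0,1), (0,i)` of `ℂ × ℂ`; it is the real orthonormal frame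
that belongs to the unitary coframe `φ, ψ`. -/
def realFrame : Module.Basis (Fin 2 ⊕ Fin 2) ℝ (ℂ × ℂ) := basisOneI.prod basisOneI

/-- The Hermitian inner product on `(p,q)`-covectors induced by the Hermitian metric
`φ ⊗ φ̄ + ψ ⊗ ψ̄`, conjugate linear in the first argument. The factor `1 / k!` accounts for the
orderings of the frame vectors, and the factor `1 / 2 ^ k` makes `φ`, `ψ` and their
conjugates, and with them all wedge products of distinct ones among these four, unit vectors. -/
def formInner (p q : ℕ) (α α' : formsOfType p q) : ℂ :=
  (((2 ^ (p + q) * (p + q).factorial : ℝ)⁻¹ : ℝ) : ℂ) *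
    ∑ e : Fin (p + q) → Fin 2 ⊕ Fin 2,
      conj (α.1 fun i => realFrame (e i)) * α'.1 fun i => realFrame (e i)

lemma formInner_self (p q : ℕ) (α : formsOfType p q) :
    formInner p q α α = (((2 ^ (p + q) * (p + q).factorial : ℝ)⁻¹ *
      ∑ e : Fin (p + q) → Fin 2 ⊕ Fin 2, ‖α.1 fun i => realFrame (e i)‖ ^ 2 : ℝ) : ℂ) := by
  simp only [formInner, ofReal_mul, ofReal_sum]
  congr 1
  refine Finset.sum_congr rfl fun e _ => ?_
  rw [conj_mul', ofReal_pow]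

/-- `formInner` is a positive definite Hermitian inner product. -/
@[reducible] def formCore (p q : ℕ) : InnerProductSpace.Core ℂ (formsOfType p q) where
  inner := formInner p q
  conj_inner_symm α α' := by
    simp only [formInner, map_mul, map_sum, conj_ofReal, conj_conj]
    congr 1
    exact Finset.sum_congr rfl fun e _ => mul_comm _ _
  re_inner_nonneg α := by
    rw [formInner_self, RCLike.re_to_complex, ofReal_re]
    positivity
  add_left α α' γ := by
    simp only [formInner, Submodule.coe_add, AlternatingMap.add_apply, map_add, add_mul,
      Finset.sum_add_distrib, mul_add]
  smul_left α α' c := by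
    simp only [formInner, Submodule.coe_smul, AlternatingMap.smul_apply, smul_eq_mul, map_mul,
      mul_assoc, ← Finset.mul_sum]
    ring
  definite α h := by
    rw [formInner_self, ofReal_eq_zero, mul_eq_zero] at h
    have h2 : ∑ e : Fin (p + q) → Fin 2 ⊕ Fin 2, ‖α.1 fun i => realFrame (e i)‖ ^ 2 = 0 := by
      rcases h with h | h
      · exact absurd h (by positivity)
      · exact h
    rw [Finset.sum_eq_zero_iff_of_nonneg (fun _ _ => by positivity)] at h2
    apply Subtype.ext
    refine Module.Basis.ext_alternating realFrame fun e _ => ?_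
    simpa using h2 e (Finset.mem_univ e)

instance formNormedAddCommGroup (p q : ℕ) : NormedAddCommGroup (formsOfType p q) :=
  (formCore p q).toNormedAddCommGroup

instance formInnerProductSpace (p q : ℕ) : InnerProductSpace ℂ (formsOfType p q) :=
  InnerProductSpace.ofCore (formCore p q).toCore

/-! ### The compact surface and the domain -/

/-- The subgroup of `ℂˣ` generated by `exp (2πβ)`. -/
def Gam (β : ℝ) : Subgroup ℂˣ :=
  Subgroup.zpowers (Units.mk0 (exp ((2 * Real.pi * β : ℝ) : ℂ)) (exp_ne_zero _))

/-- The elliptic curve `ℂˣ / Γ`. -/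
abbrev Ell (β : ℝ) : Type := ℂˣ ⧸ Gam β

/-- The surface `ℙ¹ × E`, where `ℙ¹ = ℂ ∪ {∞}` is the Riemann sphere. -/
def Surf (β : ℝ) : Type := OnePoint ℂ × Ell β

instance (β : ℝ) : TopologicalSpace (Surf β) :=
  inferInstanceAs (TopologicalSpace (OnePoint ℂ × Ell β))

instance (β : ℝ) : MeasurableSpace (Surf β) := borel (Surf β)

instance (β : ℝ) : BorelSpace (Surf β) := ⟨rfl⟩

/-- The domain `{(z,[w]) : Re (z w) > 0}` of the surface `ℙ¹ × E`. -/
def domain (β : ℝ) : Set (Surf β) :=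
  {x | ∃ (z : ℂ) (w : ℂˣ), x = ((z : OnePoint ℂ), (w : Ell β)) ∧ 0 < (z * (w : ℂ)).re}

/-- The inhomogeneous coordinate `z` (with value `0` at infinity, where it is not used). -/
def coordZ {β : ℝ} (x : Surf β) : ℂ := OnePoint.elim x.1 0 id

/-- The holomorphic covering `(z,s) ↦ (z, [exp s])` of `ℂ × E`. Its local inverses are the
holomorphic coordinates `(z, s)`, `s = log w`, of `ℂ × E`; in these `ψ = dw / w = ds`. -/
def cover (β : ℝ) (y : ℂ × ℂ) : Surf β :=
  ((y.1 : OnePoint ℂ), (Units.mk0 (exp y.2) (exp_ne_zero _) : Ell β))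

/-- A fundamental domain of `cover`: all `z`, and `0 ≤ Re s < 2πβ`, `0 ≤ Im s < 2π`. -/
def fundDomain (β : ℝ) : Set (ℂ × ℂ) :=
  {y | y.2.re ∈ Set.Ico 0 (2 * Real.pi * β) ∧ y.2.im ∈ Set.Ico 0 (2 * Real.pi)}

/-- The Riemannian volume of `ℙ¹ × E` for the metric in which `φ = dz / (1 + |z|²)` and
`ψ = dw / w` are a unitary coframe: in the coordinates `(z,s)` it has the density
`(1 + |z|²)⁻²` with respect to Lebesgue measure (and `{∞} × E` is a null set). -/
def surfVolume (β : ℝ) : Measure (Surf β) :=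
  (((volume : Measure (ℂ × ℂ)).restrict (fundDomain β)).withDensity
    fun y => ENNReal.ofReal (((1 + ‖y.1‖ ^ 2) ^ 2)⁻¹)).map (cover β)

/-- The Riemannian volume of the domain. -/
def domVolume (β : ℝ) : Measure (Surf β) := (surfVolume β).restrict (domain β)

lemma continuous_cover (β : ℝ) : Continuous (cover β) := by
  refine Continuous.prodMk (OnePoint.continuous_coe.comp continuous_fst) ?_
  refine continuous_quotient_mk'.comp ?_
  refine Units.continuous_iff.2 ⟨?_, ?_⟩
  · exact continuous_exp.comp continuous_snd
  · have : (fun y : ℂ × ℂ => exp (-y.2)) = 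
        (fun y : ℂ × ℂ => ((Units.mk0 (exp y.2) (exp_ne_zero _))⁻¹ : ℂˣ).val) := by
      funext y; simp [exp_neg]
    change Continuous (fun y : ℂ × ℂ => ((Units.mk0 (exp y.2) (exp_ne_zero _))⁻¹ : ℂˣ).val)
    rw [← this]
    exact continuous_exp.comp continuous_snd.neg

instance finite_surfVolume (β : ℝ) : IsFiniteMeasure (surfVolume β) := by
  have hset : fundDomain β = Set.univ ×ˢ
      (Set.Ico 0 (2 * Real.pi * β) ×ℂ Set.Ico 0 (2 * Real.pi)) := by
    ext y; simp [fundDomain, mem_reProdIm]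
  have hbdd : Bornology.IsBounded
      (Set.Ico 0 (2 * Real.pi * β) ×ℂ Set.Ico 0 (2 * Real.pi)) :=
    (Metric.isBounded_Ico _ _).reProdIm (Metric.isBounded_Ico _ _)
  have hint : Integrable (fun z : ℂ => ((1 + ‖z‖ ^ 2) ^ 2)⁻¹) volume := by
    have := integrable_rpow_neg_one_add_norm_sq (E := ℂ) (μ := volume) (r := 4)
      (by rw [finrank_real_complex]; norm_num)
    refine this.congr (Filter.Eventually.of_forall fun z => ?_)
    have : (-4 / 2 : ℝ) = -((2 : ℕ) : ℝ) := by norm_num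
    simp only [this]
    rw [Real.rpow_neg (by positivity), Real.rpow_natCast]
  have hfin : IsFiniteMeasure ((volume : Measure ℂ).restrict
      (Set.Ico 0 (2 * Real.pi * β) ×ℂ Set.Ico 0 (2 * Real.pi))) :=
    ⟨by rw [Measure.restrict_apply_univ]; exact hbdd.measure_lt_top⟩
  have h2 : Integrable (fun y : ℂ × ℂ => ((1 + ‖y.1‖ ^ 2) ^ 2)⁻¹)
      ((volume : Measure (ℂ × ℂ)).restrict (fundDomain β)) := by
    rw [hset, Measure.volume_eq_prod, ← Measure.prod_restrict, Measure.restrict_univ]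
    exact hint.comp_fst _
  have : IsFiniteMeasure (((volume : Measure (ℂ × ℂ)).restrict (fundDomain β)).withDensity
      fun y => ENNReal.ofReal (((1 + ‖y.1‖ ^ 2) ^ 2)⁻¹)) := isFiniteMeasure_withDensity_ofReal h2.2
  unfold surfVolume
  infer_instance

instance finite_domVolume (β : ℝ) : IsFiniteMeasure (domVolume β) := by
  unfold domVolume; infer_instance

/-! ### Square integrable forms and the operator `∂̄` -/

/-- The Hilbert space of square integrable `(p,q)`-forms on the domain. The value of a form at
a point is an alternating form on the tangent space, which is identified with `ℂ × ℂ` by the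
unitary coframe `φ = dz / (1 + |z|²)`, `ψ = dw / w`, defined on the whole domain. -/
abbrev L2Form (β : ℝ) (p q : ℕ) : Type := Lp (formsOfType p q) 2 (domVolume β)

/-- The part of `ℂ × ℂ` that covers the domain. -/
def coverDomain : Set (ℂ × ℂ) := {y | 0 < (y.1 * exp y.2).re}

lemma cover_preimage_domain (β : ℝ) : cover β ⁻¹' domain β = coverDomain := by
  ext ⟨z, s⟩
  simp only [Set.mem_preimage, domain, coverDomain, Set.mem_ofPred_eq, cover]
  constructor
  · rintro ⟨z', w, h, hpos⟩
    obtain ⟨h1, h2⟩ := Prod.mk.inj h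
    obtain rfl := OnePoint.coe_injective h1
    obtain ⟨n, hn⟩ := Subgroup.mem_zpowers_iff.1 (QuotientGroup.eq.1 h2)
    have hw : (w : ℂ) = exp s * ((Real.exp (2 * Real.pi * β) ^ n : ℝ) : ℂ) := by
      have := congrArg Units.val (eq_mul_of_inv_mul_eq hn.symm)
      simpa [Units.val_zpow_eq_zpow_val] using this
    rw [hw, ← mul_assoc, re_mul_ofReal] at hpos
    exact (mul_pos_iff_of_pos_right (by positivity)).1 hpos
  · intro h
    exact ⟨z, Units.mk0 (exp s) (exp_ne_zero _), rfl, h⟩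

/-- The pull-back of a form under `cover`, a form on the open set `coverDomain` of `ℂ × ℂ`:
a tangent vector `v = (v₁, v₂)` at `(z,s)` has `φ v = v₁ / (1 + |z|²)` and `ψ v = v₂`. -/
def pullback {β : ℝ} {p q : ℕ} (f : Surf β → formsOfType p q) (y : ℂ × ℂ)
    (v : Fin (p + q) → ℂ × ℂ) : ℂ :=
  (f (cover β y)).1 fun i => ((v i).1 / ((1 + ‖y.1‖ ^ 2 : ℝ) : ℂ), (v i).2)

/-- The derivative `∂̄_v χ = (D χ (v) + i D χ (i v)) / 2`, that is, the conjugate linear part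
of the real differential of `χ` applied to `v`. -/
def dbarDir (χ : ℂ × ℂ → ℂ) (y v : ℂ × ℂ) : ℂ :=
  (fderiv ℝ χ y v + I * fderiv ℝ χ y (I • v)) / 2

/-- Test functions on the open set `coverDomain`. -/
def IsTest (χ : ℂ × ℂ → ℂ) : Prop :=
  ContDiff ℝ ∞ χ ∧ HasCompactSupport χ ∧ tsupport χ ⊆ coverDomain

/-- `∂̄ f = g` in the sense of distributions, for a `(p,q)`-form `f` and a `(p,q+1)`-form `g`.
For a smooth form `F` on an open set of `ℂ × ℂ`,
`(∂̄ F) (v₀, …, vₖ) = ∑ i, (-1) ^ i * (∂̄_{vᵢ} F) (v₀, …, v̂ᵢ, …, vₖ)`;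
here the derivatives of the coefficients are moved to the test function. Distributional
identities are local, so they may be tested in the coordinates given by `cover`. -/
def IsWeakDbar {β : ℝ} {p q : ℕ} (f : L2Form β p q) (g : L2Form β p (q + 1)) : Prop :=
  ∀ χ : ℂ × ℂ → ℂ, IsTest χ → ∀ v : Fin (p + q + 1) → ℂ × ℂ,
    ∫ y, χ y * pullback g y v =
      -∫ y, ∑ i : Fin (p + q + 1),
        (-1) ^ (i : ℕ) * dbarDir χ y (v i) * pullback f y (fun j => v (i.succAbove j))

/-- The square integrable `(2,0)`-forms `u dz ∧ ψ` with `u` a function of `z` alone. -/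
def zOnly20 (β : ℝ) : Submodule ℂ (L2Form β 2 0) where
  carrier := {f | ∃ u : ℂ → ℂ, Measurable u ∧ ∀ᵐ x ∂domVolume β,
    (f x).1 = u (coordZ x) • wedge ![dzAt (coordZ x), psi]}
  zero_mem' := by
    refine ⟨0, measurable_zero, ?_⟩
    filter_upwards [Lp.coeFn_zero (formsOfType 2 0) 2 (domVolume β)] with x hx
    rw [hx]; simp
  add_mem' := by
    rintro f g ⟨u, hu, hf⟩ ⟨v, hv, hg⟩
    refine ⟨u + v, hu.add hv, ?_⟩
    filter_upwards [hf, hg, Lp.coeFn_add f g] with x h1 h2 h3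
    rw [h3, Pi.add_apply, Submodule.coe_add, h1, h2, Pi.add_apply, add_smul]
  smul_mem' := by
    rintro c f ⟨u, hu, hf⟩
    refine ⟨c • u, hu.const_smul c, ?_⟩
    filter_upwards [hf, Lp.coeFn_smul c f] with x h1 h3
    rw [h3, Pi.smul_apply, Submodule.coe_smul, h1, Pi.smul_apply, smul_assoc]

/-- The square integrable `(2,1)`-forms `v dz̄ ∧ dz ∧ ψ` with `v` a function of `z` alone. -/
def zOnly21 (β : ℝ) : Submodule ℂ (L2Form β 2 1) where
  carrier := {f | ∃ u : ℂ → ℂ, Measurable u ∧ ∀ᵐ x ∂domVolume β,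
    (f x).1 = u (coordZ x) • wedge ![conjCov (dzAt (coordZ x)), dzAt (coordZ x), psi]}
  zero_mem' := by
    refine ⟨0, measurable_zero, ?_⟩
    filter_upwards [Lp.coeFn_zero (formsOfType 2 1) 2 (domVolume β)] with x hx
    rw [hx]; simp
  add_mem' := by
    rintro f g ⟨u, hu, hf⟩ ⟨v, hv, hg⟩
    refine ⟨u + v, hu.add hv, ?_⟩
    filter_upwards [hf, hg, Lp.coeFn_add f g] with x h1 h2 h3
    rw [h3, Pi.add_apply, Submodule.coe_add, h1, h2, Pi.add_apply, add_smul]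
  smul_mem' := by
    rintro c f ⟨u, hu, hf⟩
    refine ⟨c • u, hu.const_smul c, ?_⟩
    filter_upwards [hf, Lp.coeFn_smul c f] with x h1 h3
    rw [h3, Pi.smul_apply, Submodule.coe_smul, h1, Pi.smul_apply, smul_assoc]

/-- The range of the maximal realization of `∂̄` on the forms in `zOnly20`: all square
integrable `(2,1)`-forms that are `∂̄ f` in the sense of distributions for some `f`
in `zOnly20`. -/
def dbarRangeZOnly (β : ℝ) : Set (L2Form β 2 1) := {g | ∃ f ∈ zOnly20 β, IsWeakDbar f g}

/-- The `(2,1)`-covector `φ̄ ∧ φ ∧ ψ`. -/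
def phiBarPhiPsi : formsOfType 2 1 :=
  ⟨wedge ![conjCov phi, phi, psi], by
    intro c v
    simp [wedge_apply, Matrix.det_fin_three, conjCov, phi, psi]
    ring⟩

/-- The `(2,1)`-form `φ̄ ∧ φ ∧ ψ` as a square integrable form on the domain. -/
def gForm (β : ℝ) : L2Form β 2 1 :=
  (memLp_const phiBarPhiPsi : MemLp (fun _ : Surf β => phiBarPhiPsi) 2 (domVolume β)).toLp _

end

end OhsawaDomain

/-! Everything reduces to the plane. Over each `z ≠ 0` the fibre of the domain is a rotated half of
the torus, so its volume does not depend on `z` (`map_coordZ_domVolume`); nothing lies over `0` or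
`∞`. Hence, up to constants, `u dz ∧ ψ` has squared norm `∫ |u|²`, `v dz̄ ∧ dz ∧ ψ` has squared norm
`∫ (1 + |z|²)² |v|²`, and pairing the latter with `φ̄ ∧ φ ∧ ψ` gives `∫ v`. The claim becomes: for
`(1 + |z|²) v` in `L²`, the equation `∂u/∂z̄ = v` on the punctured plane has a solution `u` in `L²`
if and only if `∫ v = 0`.

Necessity (`integral_eq_zero_of_weakDbarOn`): `0` and `∞` are removable for `L²` solutions. The
equation is tested with cutoffs that exhaust the punctured plane; their `∂̄` has bounded `L²` norm,
by scale invariance in real dimension two, and its support escapes from every point, so the side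
with `u` tends to `0` while the other tends to `∫ v`.

Sufficiency (`exists_weakDbar_eq`): on the Fourier side one divides `v̂` by `πiξ`. The weight gives
`v` a moment of order `1/2`, so mean zero yields `|v̂(ξ)| ≤ C |ξ|^(1/2)`; the quotient is then
square integrable near the origin, and away from it because `v̂` is.

It must also be shown that a square integrable `∂̄ (u dz ∧ ψ)` has a coefficient depending on `z`
alone (`IsWeakDbar.exists_coeff`). Averaging over a window in `s = log w` yields a function of `z`,
but no single window fits inside the fibres for all arguments of `z`. Four windows on four cones are
used and the averages glued by a partition of unity; uniqueness of distributional derivatives then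
identifies all components.

The range is thus the kernel of a continuous functional on a closed subspace, hence closed. -/

namespace OhsawaDomain

noncomputable section

open Filter Topology

/-! ### The Cauchy–Riemann equation on the plane -/

section Fourier

open FourierTransform SchwartzMap

/-- The derivative `∂θ/∂z̄` of a function on the plane. -/
def dbar (θ : ℂ → ℂ) (z : ℂ) : ℂ := (fderiv ℝ θ z 1 + I * fderiv ℝ θ z I) / 2

/-- Smooth functions on the plane with compact support in `S`. -/
def IsPlaneTest (S : Set ℂ) (θ : ℂ → ℂ) : Prop :=
  ContDiff ℝ ∞ θ ∧ HasCompactSupport θ ∧ tsupport θ ⊆ S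

/-- `∂u/∂z̄ = v` on `S` in the sense of distributions. -/
def WeakDbarOn (S : Set ℂ) (u v : ℂ → ℂ) : Prop :=
  ∀ θ, IsPlaneTest S θ → ∫ z, θ z * v z = -∫ z, u z * dbar θ z

lemma continuous_dbar {θ : ℂ → ℂ} (h : ContDiff ℝ ∞ θ) : Continuous (dbar θ) := by
  have := h.continuous_fderiv (by simp)
  unfold dbar
  fun_prop

lemma tsupport_dbar_subset (θ : ℂ → ℂ) : tsupport (dbar θ) ⊆ tsupport θ := by
  refine closure_minimal (fun z hz => ?_) (isClosed_tsupport _)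
  by_contra h
  have : fderiv ℝ θ z = 0 := by
    by_contra h0
    exact h (support_fderiv_subset ℝ h0)
  exact hz (by simp [dbar, this])

lemma hasCompactSupport_dbar {θ : ℂ → ℂ} (h : HasCompactSupport θ) :
    HasCompactSupport (dbar θ) :=
  h.mono' ((subset_tsupport _).trans (tsupport_dbar_subset θ))

/-! ### Fourier integrals and the Fourier transform on `L²` -/

lemma integral_fourier_mul {f : ℂ → ℂ} (h1 : Integrable f) (g : 𝓢(ℂ, ℂ)) :
    ∫ x, 𝓕 f x * g x = ∫ x, f x * 𝓕 g x := by
  simpa [SchwartzMap.fourier_coe] using! VectorFourier.integral_fourierIntegral_smul_eq_flip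
    (L := innerₗ ℂ) Real.continuous_fourierChar continuous_inner h1 g.integrable

lemma continuous_fourier_of_integrable {f : ℂ → ℂ} (h1 : Integrable f) : Continuous (𝓕 f) :=
  VectorFourier.fourierIntegral_continuous (L := innerₗ ℂ) Real.continuous_fourierChar
    continuous_inner h1

/-- The `L²` transform agrees with the transform of tempered distributions; this makes it testable
against Schwartz functions. -/
lemma integral_mul_L2_fourier (f : Lp ℂ 2 (volume : Measure ℂ)) (g : 𝓢(ℂ, ℂ)) :
    ∫ x, g x * (𝓕 f : Lp ℂ 2 (volume : Measure ℂ)) x = ∫ x, (𝓕 g) x * f x := by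
  have := congrArg (fun T => T g) (Lp.fourier_toTemperedDistribution_eq f)
  simpa using this.symm

lemma integral_mul_L2_fourierInv (f : Lp ℂ 2 (volume : Measure ℂ)) (g : 𝓢(ℂ, ℂ)) :
    ∫ x, g x * (𝓕⁻ f : Lp ℂ 2 (volume : Measure ℂ)) x = ∫ x, (𝓕⁻ g) x * f x := by
  have := congrArg (fun T => T g) (Lp.fourierInv_toTemperedDistribution_eq f)
  simpa using this.symm

/-- The Fourier integral of a function in `L¹ ∩ L²` is square integrable. -/
lemma memLp_fourier {f : ℂ → ℂ} (h1 : Integrable f) (h2 : MemLp f 2 volume) :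
    MemLp (𝓕 f) 2 volume := by
  -- The `L²` transform and the Fourier integral have equal pairings with all test functions, hence
  -- agree almost everywhere.
  have key : ∀ᵐ x, (𝓕 (h2.toLp f) : Lp ℂ 2 (volume : Measure ℂ)) x = 𝓕 f x := by
    refine ae_eq_of_integral_contDiff_smul_eq
      ((Lp.memLp (𝓕 (h2.toLp f))).locallyIntegrable (by norm_num))
      (continuous_fourier_of_integrable h1).locallyIntegrable fun g hg hgc => ?_
    have hgc' : HasCompactSupport (fun x => (g x : ℂ)) := hgc.comp_left (g := ofReal) rfl
    let G : 𝓢(ℂ, ℂ) := hgc'.toSchwartzMap (ofRealCLM.contDiff.comp hg)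
    have hG : ∀ x, G x = g x := fun x => rfl
    have e1 := integral_mul_L2_fourier (h2.toLp f) G
    have e2 := integral_fourier_mul h1 G
    simp only [real_smul, ← hG]
    rw [e1]
    simp_rw [mul_comm (G _)]
    rw [e2]
    refine integral_congr_ae ?_
    filter_upwards [h2.coeFn_toLp] with x hx
    rw [hx, mul_comm]
  exact (memLp_congr_ae key).1 (Lp.memLp _)

/-- Geometric mean of the bounds `2π|t|` and `2`. Order `1/2` is used because the weight does not
control a first moment: `|z|² (1 + |z|²)⁻²` fails to be integrable at infinity, logarithmically. -/
lemma norm_fourierChar_sub_one_le (t : ℝ) :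
    ‖((Real.fourierChar t : Circle) : ℂ) - 1‖ ≤ 2 * √(Real.pi * |t|) := by
  have h1 : ‖((Real.fourierChar t : Circle) : ℂ) - 1‖ ≤ 2 * Real.pi * |t| := by
    rw [Real.fourierChar_apply, mul_comm _ I]
    refine Real.norm_exp_I_mul_ofReal_sub_one_le.trans ?_
    rw [Real.norm_eq_abs, abs_mul, abs_of_pos Real.two_pi_pos]
  have h2 : ‖((Real.fourierChar t : Circle) : ℂ) - 1‖ ≤ 2 := by
    refine (norm_sub_le _ _).trans ?_
    rw [Circle.norm_coe, norm_one]; norm_num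
  set a := ‖((Real.fourierChar t : Circle) : ℂ) - 1‖
  have h0 : 0 ≤ a := norm_nonneg _
  rw [← div_le_iff₀' two_pos]
  refine Real.le_sqrt_of_sq_le ?_
  nlinarith

/-- The Fourier integral of a function with mean zero and a moment of order `1/2` vanishes at the
origin to order `1/2`. -/
lemma norm_fourier_le_sqrt {f : ℂ → ℂ} (h1 : Integrable f)
    (hs : Integrable fun z => √‖z‖ * ‖f z‖) (h0 : ∫ z, f z = 0) :
    ∃ C, ∀ ξ, ‖𝓕 f ξ‖ ≤ C * √‖ξ‖ := by
  refine ⟨2 * √Real.pi * ∫ z, √‖z‖ * ‖f z‖, fun ξ => ?_⟩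
  have hint : Integrable fun z => Real.fourierChar (-⟪z, ξ⟫_ℝ) • f z := by
    refine (Real.fourierIntegral_convergent_iff ξ).2 h1
  have e : 𝓕 f ξ = ∫ z, (((Real.fourierChar (-⟪z, ξ⟫_ℝ) : Circle) : ℂ) - 1) * f z := by
    rw [Real.fourier_eq, ← sub_zero (∫ z, _), ← h0, ← integral_sub hint h1]
    congr 1; ext z
    rw [Circle.smul_def, smul_eq_mul]; ring
  rw [e]
  calc _ ≤ ∫ z, (2 * √Real.pi * √‖ξ‖) * (√‖z‖ * ‖f z‖) := by
        refine norm_integral_le_of_norm_le (hs.const_mul _) (Eventually.of_forall fun z => ?_)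
        rw [norm_mul]
        have := norm_fourierChar_sub_one_le (-⟪z, ξ⟫_ℝ)
        rw [Real.sqrt_mul Real.pi_pos.le, abs_neg] at this
        have h3 : √|⟪z, ξ⟫_ℝ| ≤ √‖z‖ * √‖ξ‖ := by
          rw [← Real.sqrt_mul (norm_nonneg _)]
          exact Real.sqrt_le_sqrt (abs_real_inner_le_norm _ _)
        calc _ ≤ (2 * (√Real.pi * (√‖z‖ * √‖ξ‖))) * ‖f z‖ := by
              gcongr
              exact this.trans (by gcongr)
          _ = _ := by ring
    _ = _ := by rw [integral_const_mul]; ring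

/-! ### Weights on the plane -/

lemma integrable_one_add_norm_sq_rpow {r : ℝ} (hr : 1 < r) :
    Integrable fun z : ℂ => (1 + ‖z‖ ^ 2) ^ (-r) := by
  have := integrable_rpow_neg_one_add_norm_sq (E := ℂ) (μ := volume) (r := 2 * r)
    (by rw [finrank_real_complex]; norm_num; linarith)
  simpa [neg_div] using this

lemma integrable_inv_norm_ball :
    IntegrableOn (fun z : ℂ => ‖z‖⁻¹) (Metric.ball 0 1) volume := by
  rw [integrableOn_fun_norm_addHaar (f := fun r => r⁻¹) volume]
  refine IntegrableOn.congr_fun (f := fun _ => (1 : ℝ)) ?_ (fun y hy => ?_) measurableSet_Ioo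
  · simp
  · simp [hy.1.ne']

lemma memLp_two_of_norm_sq_le {f : ℂ → ℂ} {g : ℂ → ℝ} (hf : AEStronglyMeasurable f volume)
    (hg : Integrable g) (h : ∀ z, ‖f z‖ ^ 2 ≤ g z) : MemLp f 2 volume := by
  rw [memLp_two_iff_integrable_sq_norm hf]
  refine hg.mono' (hf.norm.pow 2) (Eventually.of_forall fun z => ?_)
  rw [Real.norm_of_nonneg (by positivity)]
  exact h z

lemma memLp_weight :
    MemLp (fun z : ℂ => (((1 + ‖z‖ ^ 2)⁻¹ : ℝ) : ℂ)) 2 volume := by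
  refine memLp_two_of_norm_sq_le ?_ (integrable_one_add_norm_sq_rpow (r := 2) one_lt_two) fun z => ?_
  · exact Continuous.aestronglyMeasurable (continuous_ofReal.comp
      (Continuous.inv₀ (by fun_prop) fun z => by positivity))
  · rw [norm_real, Real.norm_of_nonneg (by positivity), Real.rpow_neg (by positivity)]
    norm_num

/-- The square is at most `(1 + |z|²)^(-3/2)`, which decays like `|z|⁻³` in real dimension two. -/
lemma memLp_sqrt_weight :
    MemLp (fun z : ℂ => ((√‖z‖ * (1 + ‖z‖ ^ 2)⁻¹ : ℝ) : ℂ)) 2 volume := by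
  refine memLp_two_of_norm_sq_le ?_ (integrable_one_add_norm_sq_rpow (r := 3 / 2) (by norm_num))
    fun z => ?_
  · exact Continuous.aestronglyMeasurable (continuous_ofReal.comp
      (Continuous.mul (by fun_prop) (Continuous.inv₀ (by fun_prop) fun z => by positivity)))
  · have hp : (0 : ℝ) < 1 + ‖z‖ ^ 2 := by positivity
    rw [norm_real, Real.norm_of_nonneg (by positivity), mul_pow, Real.sq_sqrt (norm_nonneg _)]
    have : (1 + ‖z‖ ^ 2) ^ (-(3 / 2) : ℝ) = √(1 + ‖z‖ ^ 2) * ((1 + ‖z‖ ^ 2)⁻¹) ^ 2 := by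
      rw [show (-(3 / 2) : ℝ) = 1 / 2 - 2 by norm_num, Real.rpow_sub hp, ← Real.sqrt_eq_rpow]
      norm_num [div_eq_mul_inv]
    rw [this]
    gcongr
    exact Real.le_sqrt_of_sq_le (by linarith)

section weighted

variable {v : ℂ → ℂ}

/-- The factorization behind the Cauchy–Schwarz estimates below: a square integrable weight times
the weighted function. -/
lemma eq_weight_mul (v : ℂ → ℂ) (z : ℂ) :
    v z = (((1 + ‖z‖ ^ 2)⁻¹ : ℝ) : ℂ) * (((1 + ‖z‖ ^ 2 : ℝ) : ℂ) * v z) := by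
  have : ((1 + ‖z‖ ^ 2 : ℝ) : ℂ) ≠ 0 := by exact_mod_cast (by positivity)
  rw [ofReal_inv, inv_mul_cancel_left₀ this]

lemma integrable_of_weighted (hv : MemLp (fun z => ((1 + ‖z‖ ^ 2 : ℝ) : ℂ) * v z) 2 volume) :
    Integrable v := by
  refine (memLp_weight.integrable_mul hv).congr (Eventually.of_forall fun z => ?_)
  exact (eq_weight_mul v z).symm

lemma integrable_sqrt_of_weighted
    (hv : MemLp (fun z => ((1 + ‖z‖ ^ 2 : ℝ) : ℂ) * v z) 2 volume) :
    Integrable fun z => √‖z‖ * ‖v z‖ := by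
  refine (memLp_sqrt_weight.integrable_mul hv).norm.congr (Eventually.of_forall fun z => ?_)
  simp only [Pi.mul_apply]
  rw [ofReal_mul, mul_assoc, ← eq_weight_mul v z, norm_mul, norm_real,
    Real.norm_of_nonneg (Real.sqrt_nonneg _)]

lemma memLp_of_weighted (hv : MemLp (fun z => ((1 + ‖z‖ ^ 2 : ℝ) : ℂ) * v z) 2 volume) :
    MemLp v 2 volume := by
  refine hv.mono (integrable_of_weighted hv).1 (Eventually.of_forall fun z => ?_)
  rw [norm_mul, norm_real, Real.norm_of_nonneg (by positivity)]
  nlinarith [norm_nonneg (v z), sq_nonneg ‖z‖, mul_nonneg (sq_nonneg ‖z‖) (norm_nonneg (v z))]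

end weighted

-- With `∂/∂z̄ = (∂₁ + i ∂_i) / 2` and the factor `-2πi ⟨ξ, m⟩` for `∂_m`, the symbol is `-πi (Re ξ
-- + i Im ξ) = -πiξ`.
open LineDeriv in
lemma fourierInv_dbar (θ D : 𝓢(ℂ, ℂ)) (hD : ∀ z, D z = dbar θ z) (ξ : ℂ) :
    (𝓕⁻ D) ξ = -(Real.pi * I * ξ) * (𝓕⁻ θ) ξ := by
  have e : D = (1 / 2 : ℂ) • (∂_{(1 : ℂ)} θ + I • ∂_{I} θ) := by
    ext z
    simp [hD, dbar, lineDerivOp_apply_eq_fderiv]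
    ring
  have key (m : ℂ) : (𝓕⁻ (∂_{m} θ)) ξ = -(2 * Real.pi * I) * (inner ℝ ξ m : ℝ) * (𝓕⁻ θ) ξ := by
    rw [fourierInv_lineDerivOp_eq]
    have : Function.HasTemperateGrowth fun x : ℂ => ⟪x, m⟫_ℝ :=
      ((innerSL ℝ (E := ℂ)).flip m).hasTemperateGrowth
    rw [smul_apply, SchwartzMap.smulLeftCLM_apply_apply this]
    simp only [smul_eq_mul, real_smul, mul_assoc]
  rw [e, FourierTransform.fourierInv_smul, FourierTransform.fourierInv_add,
    FourierTransform.fourierInv_smul, smul_apply, add_apply, smul_apply, key, key]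
  simp only [Complex.inner, smul_eq_mul]
  generalize (𝓕⁻ θ) ξ = t
  simp
  conv_rhs => rw [← re_add_im ξ]
  ring

/-- A weighted square integrable function with mean zero is `∂u/∂z̄` for some square
integrable `u`. -/
theorem exists_weakDbar_eq {v : ℂ → ℂ}
    (hv : MemLp (fun z => ((1 + ‖z‖ ^ 2 : ℝ) : ℂ) * v z) 2 volume) (h0 : ∫ z, v z = 0) :
    ∃ u : ℂ → ℂ, Measurable u ∧ MemLp u 2 volume ∧ WeakDbarOn Set.univ u v := by
  have h1 := integrable_of_weighted hv
  have hV2 := memLp_fourier h1 (memLp_of_weighted hv)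
  have hVc := continuous_fourier_of_integrable h1
  obtain ⟨C, hC⟩ := norm_fourier_le_sqrt h1 (integrable_sqrt_of_weighted hv) h0
  set V := 𝓕 v
  -- The candidate for the Fourier transform of `u`. Its default value `0` at `ξ = 0` is immaterial.
  let W : ℂ → ℂ := fun ξ => V ξ / (Real.pi * I * ξ)
  have hWm : Measurable W := hVc.measurable.div (by fun_prop)
  have hW : MemLp W 2 volume := by
    -- In the unit ball `|W|² ≤ C² / |ξ|` by the half-order vanishing of `V`; outside it `π|ξ| ≥ 1`,
    -- so `|W| ≤ |V|`.
    refine memLp_two_of_norm_sq_le hWm.aestronglyMeasurable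
      (g := fun ξ => (Metric.ball (0 : ℂ) 1).indicator (fun z : ℂ => C ^ 2 * ‖z‖⁻¹) ξ + ‖V ξ‖ ^ 2)
      ?_ fun ξ => ?_
    · refine Integrable.add ?_ ((memLp_two_iff_integrable_sq_norm hV2.1).1 hV2)
      exact (integrable_indicator_iff measurableSet_ball).2 (integrable_inv_norm_ball.const_mul _)
    · have hn : ‖W ξ‖ = ‖V ξ‖ / (Real.pi * ‖ξ‖) := by
        simp [W, abs_of_pos Real.pi_pos]
      have hpi : 1 ≤ Real.pi := by linarith [Real.pi_gt_three]
      rw [hn]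
      by_cases hb : ξ ∈ Metric.ball (0 : ℂ) 1
      · rw [Set.indicator_of_mem hb]
        rcases eq_or_ne ξ 0 with rfl | hξ
        · simp
        have hx : 0 < ‖ξ‖ := norm_pos_iff.2 hξ
        have : ‖V ξ‖ / (Real.pi * ‖ξ‖) ≤ C * √‖ξ‖ / (1 * ‖ξ‖) := by
          gcongr
          · exact (norm_nonneg _).trans (hC ξ)
          · exact hC ξ
        calc _ ≤ (C * √‖ξ‖ / (1 * ‖ξ‖)) ^ 2 := by gcongr
          _ = C ^ 2 * ‖ξ‖⁻¹ := by
            rw [div_pow, mul_pow, Real.sq_sqrt hx.le]; field_simp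
          _ ≤ _ := by linarith [sq_nonneg ‖V ξ‖]
      · rw [Set.indicator_of_notMem hb, zero_add]
        have hx : 1 ≤ ‖ξ‖ := by simpa using hb
        gcongr
        refine div_le_self (norm_nonneg _) ?_
        nlinarith
  let uL : Lp ℂ 2 (volume : Measure ℂ) := 𝓕⁻ (hW.toLp W)
  refine ⟨uL, (Lp.stronglyMeasurable uL).measurable, Lp.memLp uL, fun θ hθ => ?_⟩
  let T : 𝓢(ℂ, ℂ) := hθ.2.1.toSchwartzMap hθ.1
  have hdc : ContDiff ℝ ∞ (dbar θ) := by
    have : ContDiff ℝ ∞ (fderiv ℝ θ) := hθ.1.fderiv_right (by simp)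
    unfold dbar
    fun_prop
  let D : 𝓢(ℂ, ℂ) := (hasCompactSupport_dbar hθ.2.1).toSchwartzMap hdc
  have hT : ∀ z, T z = θ z := fun _ => rfl
  have hD : ∀ z, D z = dbar θ z := fun _ => rfl
  -- The transform is moved to the test function. Its symbol `-πiξ` then cancels the denominator of
  -- `W`, and Fourier inversion returns `-∫ v θ`.
  have e1 : ∫ z, uL z * dbar θ z = ∫ z, (𝓕⁻ D) z * W z := by
    simp_rw [← hD, mul_comm (uL _)]
    rw [integral_mul_L2_fourierInv]
    refine integral_congr_ae ?_
    filter_upwards [hW.coeFn_toLp] with x hx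
    rw [hx]
  have e2 : ∫ z, (𝓕⁻ D) z * W z = -∫ z, V z * (𝓕⁻ T) z := by
    rw [← integral_neg]
    refine integral_congr_ae ?_
    filter_upwards [compl_mem_ae_iff.2 (measure_singleton (0 : ℂ))] with ξ hξ
    have hξ : ξ ≠ 0 := hξ
    have hpi : (Real.pi : ℂ) ≠ 0 := by exact_mod_cast Real.pi_ne_zero
    rw [fourierInv_dbar T D hD]
    simp only [W]
    field_simp [I_ne_zero]
  rw [e1, e2, integral_fourier_mul h1, FourierTransform.fourier_fourierInv_eq, neg_neg]
  simp_rw [hT, mul_comm]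

end Fourier

/-! ### Removability of the origin and of infinity -/

/-- A radial cutoff function on the plane. -/
def planeBump : ContDiffBump (0 : ℂ) := ⟨1, 2, one_pos, one_lt_two⟩

/-- The dilate of the radial cutoff function, with complex values. -/
def cutoff (t : ℝ) (z : ℂ) : ℂ := (planeBump (t • z) : ℂ)

lemma contDiff_cutoff (t : ℝ) : ContDiff ℝ ∞ (cutoff t) :=
  ofRealCLM.contDiff.comp (planeBump.contDiff.comp (contDiff_const_smul t))

lemma cutoff_eq_one {t : ℝ} {z : ℂ} (h : ‖t • z‖ ≤ 1) : cutoff t z = 1 := by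
  have := planeBump.one_of_mem_closedBall (x := t • z) (by simpa [planeBump] using h)
  rw [cutoff, this, ofReal_one]

lemma cutoff_eq_zero {t : ℝ} {z : ℂ} (h : 2 ≤ ‖t • z‖) : cutoff t z = 0 := by
  have := planeBump.zero_of_le_dist (x := t • z) (by simpa [planeBump] using h)
  rw [cutoff, this, ofReal_zero]

lemma hasCompactSupport_cutoff {t : ℝ} (ht : t ≠ 0) : HasCompactSupport (cutoff t) :=
  (planeBump.hasCompactSupport.comp_smul ht).comp_left (g := ofReal) rfl

/-- The chain-rule factor `t` is exactly what keeps the `L²` norm on the plane independent of `t`.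
-/
lemma dbar_cutoff (t : ℝ) (z : ℂ) : dbar (cutoff t) z = t * dbar (cutoff 1) (t • z) := by
  have e : cutoff t = fun z => cutoff 1 (t • z) := by ext z; simp [cutoff]
  simp only [dbar]
  rw [e, fderiv_comp_smul]
  simp
  ring

/-- With the next lemma this confines `∂̄` of the cutoff to the annulus `1 ≤ |z| ≤ 2`, whose dilates
leave every fixed point. -/
lemma dbar_cutoff_one_of_lt {z : ℂ} (h : ‖z‖ < 1) : dbar (cutoff 1) z = 0 := by
  have : cutoff 1 =ᶠ[𝓝 z] fun _ => 1 := by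
    filter_upwards [(isOpen_lt continuous_norm continuous_const).mem_nhds h] with w hw
    exact cutoff_eq_one (by simpa using le_of_lt hw)
  simp [dbar, this.fderiv_eq]

lemma dbar_cutoff_one_of_gt {z : ℂ} (h : 2 < ‖z‖) : dbar (cutoff 1) z = 0 := by
  have : cutoff 1 =ᶠ[𝓝 z] fun _ => 0 := by
    filter_upwards [(isOpen_lt continuous_const continuous_norm).mem_nhds h] with w hw
    exact cutoff_eq_zero (by simpa using le_of_lt hw)
  simp [dbar, this.fderiv_eq]

lemma integrable_mul_of_memLp_two {u h : ℂ → ℂ} (hu : MemLp u 2 volume) (hh : Continuous h)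
    (hc : HasCompactSupport h) : Integrable fun z => u z * h z :=
  MemLp.integrable_mul (q := 2) hu (hh.memLp_of_hasCompactSupport hc)

/-- Pairings of a square integrable function with dilates that preserve the norm tend to zero
when the dilates escape from every point. -/
lemma tendsto_integral_mul_dilate {u h : ℂ → ℂ} (hu : MemLp u 2 volume) (hh : Continuous h)
    (hc : HasCompactSupport h) {t : ℕ → ℝ} (ht : ∀ n, 0 < t n)
    (hz : ∀ z, ∀ᶠ n in atTop, h (t n • z) = 0) :
    Tendsto (fun n => ∫ z, u z * (t n * h (t n • z))) atTop (𝓝 0) := by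
  -- Restricting `u` to the support set of the dilate costs nothing in the pairing, and the
  -- restricted norm tends to zero by dominated convergence.
  let A : ℕ → Set ℂ := fun n => {z | h (t n • z) ≠ 0}
  have hA : ∀ n, MeasurableSet (A n) := fun n =>
    (isOpen_ne_fun (hh.comp (continuous_const_smul _)) continuous_const).measurableSet
  have hu2 := (memLp_two_iff_integrable_sq_norm hu.1).1 hu
  have hlim : Tendsto (fun n => ∫ z, ‖(A n).indicator u z‖ ^ 2) atTop (𝓝 0) := by
    have := tendsto_integral_of_dominated_convergence (μ := (volume : Measure ℂ))
      (F := fun n z => ‖(A n).indicator u z‖ ^ 2) (f := fun _ => (0 : ℝ)) (fun z => ‖u z‖ ^ 2)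
      (fun n => ((hu.1.indicator (hA n)).norm.pow 2)) hu2
      (fun n => Eventually.of_forall fun z => ?_) (Eventually.of_forall fun z => ?_)
    · simpa using this
    · rw [Real.norm_of_nonneg (by positivity)]
      gcongr
      exact norm_indicator_le_norm_self u z
    · refine tendsto_const_nhds.congr' ?_
      filter_upwards [hz z] with n hn
      have : z ∉ A n := fun h => h hn
      simp [this]
  have hbd : ∀ n, ‖∫ z, u z * (t n * h (t n • z))‖ ≤
      √(∫ z, ‖(A n).indicator u z‖ ^ 2) * √(∫ z, ‖h z‖ ^ 2) := by
    intro n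
    have hhn : Continuous fun z : ℂ => (t n : ℂ) * h (t n • z) := by fun_prop
    have hcn : HasCompactSupport fun z : ℂ => (t n : ℂ) * h (t n • z) :=
      (hc.comp_smul (ht n).ne').mul_left
    -- The Jacobian `t⁻²` of the dilation cancels the square of the prefactor `t`.
    have hscale : ∫ z : ℂ, ‖(t n : ℂ) * h (t n • z)‖ ^ 2 = ∫ z, ‖h z‖ ^ 2 := by
      have := Measure.integral_comp_smul (volume : Measure ℂ) (fun z => ‖h z‖ ^ 2) (t n)
      simp only [norm_mul, mul_pow, integral_const_mul, this, finrank_real_complex, norm_real,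
        Real.norm_eq_abs, sq_abs, smul_eq_mul, ← mul_assoc]
      rw [abs_of_pos (by have := ht n; positivity), mul_inv_cancel₀ (by have := ht n; positivity),
        one_mul]
    have hol := integral_mul_norm_le_Lp_mul_Lq (μ := (volume : Measure ℂ))
      (f := (A n).indicator u) (g := fun z => (t n : ℂ) * h (t n • z)) Real.HolderConjugate.two_two
      (by simpa using hu.indicator (hA n))
      (by simpa using hhn.memLp_of_hasCompactSupport hcn)
    simp only [Real.rpow_two, hscale] at hol
    rw [← Real.sqrt_eq_rpow, ← Real.sqrt_eq_rpow] at hol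
    refine (norm_integral_le_integral_norm _).trans (le_trans (le_of_eq ?_) hol)
    congr 1; ext z
    by_cases hzA : z ∈ A n
    · simp [hzA]
    · have : h (t n • z) = 0 := by simpa [A] using hzA
      simp only [this, mul_zero, norm_zero]
  refine squeeze_zero_norm hbd ?_
  have := (Real.continuous_sqrt.tendsto 0).comp hlim
  simpa using this.mul_const (√(∫ z, ‖h z‖ ^ 2))

/-- If `∂u/∂z̄ = v` outside of the origin, with `u` square integrable and `v` integrable, then
`v` has mean zero. -/
theorem integral_eq_zero_of_weakDbarOn {u v : ℂ → ℂ} (hu : MemLp u 2 volume)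
    (hv : Integrable v) (h : WeakDbarOn {0}ᶜ u v) : ∫ z, v z = 0 := by
  let a : ℕ → ℝ := fun n => ((n : ℝ) + 1)⁻¹
  let b : ℕ → ℝ := fun n => (n : ℝ) + 1
  have ha : ∀ n, 0 < a n := fun n => by positivity
  have hb : ∀ n, 0 < b n := fun n => by positivity
  have hblim : Tendsto b atTop atTop := tendsto_atTop_add_const_right _ _ tendsto_natCast_atTop_atTop
  have halim : Tendsto a atTop (𝓝 0) := tendsto_inv_atTop_zero.comp hblim
  have hasmall : ∀ z : ℂ, ∀ᶠ n in atTop, ‖a n • z‖ < 1 := fun z => by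
    have : Tendsto (fun n => ‖a n • z‖) atTop (𝓝 0) := by
      simpa using (halim.smul_const z).norm
    exact this.eventually_lt_const one_pos
  have hbbig : ∀ z : ℂ, z ≠ 0 → ∀ᶠ n in atTop, 2 < ‖b n • z‖ := fun z hz => by
    have : Tendsto (fun n => ‖b n • z‖) atTop atTop := by
      simp only [norm_smul]
      exact (tendsto_norm_atTop_atTop.comp hblim).atTop_mul_const (norm_pos_iff.2 hz)
    exact this.eventually_gt_atTop 2
  -- A smooth indicator of an annulus: the first cutoff truncates near infinity, and the second
  -- removes a disc about the origin with radius of order `1/(n+1)`.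
  let θ : ℕ → ℂ → ℂ := fun n z => cutoff (a n) z - cutoff (b n) z
  have hθ : ∀ n, IsPlaneTest {0}ᶜ (θ n) := fun n => by
    refine ⟨(contDiff_cutoff _).sub (contDiff_cutoff _),
      (hasCompactSupport_cutoff (ha n).ne').sub (hasCompactSupport_cutoff (hb n).ne'), ?_⟩
    refine Set.subset_compl_singleton_iff.2 ?_
    rw [notMem_tsupport_iff_eventuallyEq]
    have hs : ∀ t : ℝ, ∀ᶠ z : ℂ in 𝓝 0, ‖t • z‖ < 1 := fun t => by
      have : Continuous fun z : ℂ => ‖t • z‖ := by fun_prop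
      exact (this.tendsto 0).eventually_lt_const (by simp)
    filter_upwards [hs (a n), hs (b n)] with z h1 h2
    simp [θ, cutoff_eq_one h1.le, cutoff_eq_one h2.le]
  have hle : ∀ n z, ‖θ n z‖ ≤ 1 := fun n z => by
    simp only [θ, cutoff, ← ofReal_sub, norm_real, Real.norm_eq_abs, abs_le]
    have := planeBump.nonneg (x := a n • z)
    have := planeBump.nonneg (x := b n • z)
    have := planeBump.le_one (x := a n • z)
    have := planeBump.le_one (x := b n • z)
    constructor <;> linarith
  have hL : Tendsto (fun n => ∫ z, θ n z * v z) atTop (𝓝 (∫ z, v z)) := by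
    refine tendsto_integral_of_dominated_convergence (fun z => ‖v z‖)
      (fun n => (hθ n).1.continuous.aestronglyMeasurable.mul hv.1) hv.norm
      (fun n => Eventually.of_forall fun z => ?_) ?_
    · rw [norm_mul]
      exact mul_le_of_le_one_left (norm_nonneg _) (hle n z)
    · filter_upwards [compl_mem_ae_iff.2 (measure_singleton (0 : ℂ))] with z hz
      refine tendsto_const_nhds.congr' ?_
      filter_upwards [hasmall z, hbbig z hz] with n h1 h2
      simp [θ, cutoff_eq_one h1.le, cutoff_eq_zero h2.le]
  have hdc := continuous_dbar (contDiff_cutoff 1)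
  have hds := hasCompactSupport_dbar (hasCompactSupport_cutoff one_ne_zero)
  have hR1 := tendsto_integral_mul_dilate hu hdc hds ha fun z => by
    filter_upwards [hasmall z] with n hn
    exact dbar_cutoff_one_of_lt hn
  have hR2 := tendsto_integral_mul_dilate hu hdc hds hb fun z => by
    rcases eq_or_ne z 0 with rfl | hz
    · exact Eventually.of_forall fun n => dbar_cutoff_one_of_lt (by simp)
    · filter_upwards [hbbig z hz] with n hn
      exact dbar_cutoff_one_of_gt hn
  have hint : ∀ t : ℝ, 0 < t → Integrable fun z => u z * (t * dbar (cutoff 1) (t • z)) :=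
    fun t ht => by
    simp_rw [← dbar_cutoff]
    exact integrable_mul_of_memLp_two hu (continuous_dbar (contDiff_cutoff t))
      (hasCompactSupport_dbar (hasCompactSupport_cutoff ht.ne'))
  have hR : Tendsto (fun n => ∫ z, θ n z * v z) atTop (𝓝 0) := by
    have := (hR1.sub hR2).neg
    rw [sub_zero, neg_zero] at this
    refine this.congr fun n => ?_
    rw [h _ (hθ n), ← integral_sub (hint _ (ha n)) (hint _ (hb n))]
    congr 1
    refine integral_congr_ae (Eventually.of_forall fun z => ?_)
    have hd := fun t => ((contDiff_cutoff t).differentiable (by simp)).differentiableAt (x := z)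
    have : dbar (θ n) z = dbar (cutoff (a n)) z - dbar (cutoff (b n)) z := by
      simp only [dbar, θ]
      rw [fderiv_fun_sub (hd _) (hd _)]
      simp only [sub_apply]
      ring
    simp only [this, dbar_cutoff (a n) z, dbar_cutoff (b n) z]
    ring
  exact tendsto_nhds_unique hL hR

/-! ### A partition of unity subordinate to four cones -/

/-- A smooth transition on the line that adds up to one with its reflection. -/
def ramp (t : ℝ) : ℝ := Real.smoothTransition (4 * t + 1 / 2)

lemma contDiff_ramp : ContDiff ℝ ∞ ramp :=
  Real.smoothTransition.contDiff.comp (by fun_prop)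

/-- The shift by `1/2` turns `t ↦ -t` into `x ↦ 1 - x`, under which the smooth transition has
complementary values. -/
lemma ramp_add_ramp_neg (t : ℝ) : ramp t + ramp (-t) = 1 := by
  have h := Real.smoothTransition.pos_denom (4 * t + 1 / 2)
  have e1 : 1 - (4 * t + 1 / 2) = 4 * -t + 1 / 2 := by ring
  have e2 : 1 - (4 * -t + 1 / 2) = 4 * t + 1 / 2 := by ring
  rw [e1] at h
  rw [ramp, ramp, Real.smoothTransition, Real.smoothTransition, e1, e2,
    add_comm (expNegInvGlue (4 * -t + 1 / 2)), ← add_div, div_self h.ne']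

/-- The zero of `4t + 1/2` is the source of the constant `1/8` in `cone`. -/
lemma lt_of_ramp_ne_zero {t : ℝ} (h : ramp t ≠ 0) : -(1 / 8) < t := by
  by_contra hn
  exact h (Real.smoothTransition.zero_of_nonpos (by linarith))

/-- The sign that belongs to a Boolean value. -/
def sgn (a : Bool) : ℝ := cond a 1 (-1)

/-- The weights of a partition of unity on the punctured plane. -/
def coneWeight (j : Bool × Bool) (z : ℂ) : ℂ :=
  ((ramp (sgn j.1 * (z.re / ‖z‖)) * ramp (sgn j.2 * (z.im / ‖z‖)) : ℝ) : ℂ)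

/-- Four cones that cover the punctured plane. -/
def cone (j : Bool × Bool) : Set ℂ :=
  {z | z ≠ 0 ∧ -(‖z‖ / 8) ≤ sgn j.1 * z.re ∧ -(‖z‖ / 8) ≤ sgn j.2 * z.im}

/-- The sum factors as `(ramp x + ramp (-x)) (ramp y + ramp (-y))`. It is `1` even at the origin,
where the quotients default to `0`. -/
lemma sum_coneWeight (z : ℂ) : ∑ j, coneWeight j z = 1 := by
  have h1 := ramp_add_ramp_neg (z.re / ‖z‖)
  have h2 := ramp_add_ramp_neg (z.im / ‖z‖)
  simp only [coneWeight, Fintype.sum_prod_type, Fintype.sum_bool, sgn, cond_true, cond_false,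
    one_mul, neg_one_mul, ← ofReal_add]
  rw [← mul_add, ← mul_add, ← add_mul, h1, h2]
  simp

lemma measurable_coneWeight (j : Bool × Bool) : Measurable (coneWeight j) := by
  have := contDiff_ramp.continuous.measurable
  unfold coneWeight
  fun_prop

lemma contDiffAt_coneWeight (j : Bool × Bool) {z : ℂ} (hz : z ≠ 0) :
    ContDiffAt ℝ ∞ (coneWeight j) z := by
  have hn : ContDiffAt ℝ ∞ (fun z : ℂ => ‖z‖) z := contDiffAt_norm ℝ hz
  have hre : ContDiffAt ℝ ∞ (fun z : ℂ => z.re) z := reCLM.contDiff.contDiffAt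
  have him : ContDiffAt ℝ ∞ (fun z : ℂ => z.im) z := imCLM.contDiff.contDiffAt
  have h0 : ‖z‖ ≠ 0 := norm_ne_zero_iff.2 hz
  refine ofRealCLM.contDiff.contDiffAt.comp z (ContDiffAt.mul ?_ ?_)
  · exact contDiff_ramp.contDiffAt.comp z (contDiffAt_const.mul (hre.div hn h0))
  · exact contDiff_ramp.contDiffAt.comp z (contDiffAt_const.mul (him.div hn h0))

/-- The test function vanishes near the origin, the only place where the weight may fail to be
smooth. The non-strict inequalities in `cone` are closed conditions, so they pass to the closure of
the support. -/
lemma isPlaneTest_mul_coneWeight {θ : ℂ → ℂ} (hθ : IsPlaneTest {0}ᶜ θ) (j : Bool × Bool) :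
    IsPlaneTest (cone j) fun z => θ z * coneWeight j z := by
  have hsub : tsupport (fun z => θ z * coneWeight j z) ⊆ tsupport θ :=
    tsupport_mul_subset_left
  refine ⟨contDiff_iff_contDiffAt.2 fun z => ?_, hθ.2.1.mul_right, fun z hz => ?_⟩
  · by_cases hz : z ∈ tsupport θ
    · exact hθ.1.contDiffAt.mul (contDiffAt_coneWeight j (hθ.2.2 hz))
    · refine (contDiffAt_const (c := (0 : ℂ))).congr_of_eventuallyEq ?_
      filter_upwards [notMem_tsupport_iff_eventuallyEq.1 hz] with w hw
      simp [hw]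
  · refine ⟨hθ.2.2 (hsub hz), ?_⟩
    have hcl : IsClosed {z : ℂ | -(‖z‖ / 8) ≤ sgn j.1 * z.re ∧ -(‖z‖ / 8) ≤ sgn j.2 * z.im} :=
      IsClosed.and (isClosed_le (by fun_prop) (by fun_prop))
        (isClosed_le (by fun_prop) (by fun_prop))
    refine closure_minimal (fun w hw => ?_) hcl hz
    have hw : θ w * coneWeight j w ≠ 0 := hw
    have hw0 : w ≠ 0 := hθ.2.2 (subset_tsupport _ (left_ne_zero_of_mul hw))
    have hp : 0 < ‖w‖ := norm_pos_iff.2 hw0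
    have h2 := right_ne_zero_of_mul hw
    rw [coneWeight, ofReal_ne_zero] at h2
    have h3 := lt_of_ramp_ne_zero (left_ne_zero_of_mul h2)
    have h4 := lt_of_ramp_ne_zero (right_ne_zero_of_mul h2)
    rw [← mul_div_assoc, lt_div_iff₀ hp] at h3 h4
    constructor <;> linarith

/-- Solutions of the Cauchy–Riemann equation on the cones are glued to one on the punctured
plane. -/
lemma weakDbarOn_of_cone {u : ℂ → ℂ} {w : Bool × Bool → ℂ → ℂ} (hu : MemLp u 2 volume)
    (hw : ∀ j θ, IsPlaneTest (cone j) θ → Integrable fun z => θ z * w j z)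
    (h : ∀ j, WeakDbarOn (cone j) u (w j)) :
    WeakDbarOn {0}ᶜ u fun z => ∑ j, coneWeight j z * w j z := by
  intro θ hθ
  have ht := fun j => isPlaneTest_mul_coneWeight hθ j
  have e1 : ∀ z, θ z * ∑ j, coneWeight j z * w j z = ∑ j, (θ z * coneWeight j z) * w j z :=
    fun z => by rw [Finset.mul_sum]; simp only [mul_assoc]
  have e2 : ∀ z, u z * dbar θ z = ∑ j, u z * dbar (fun z => θ z * coneWeight j z) z := fun z => by
    have e3 : θ = fun z => ∑ j, θ z * coneWeight j z := by
      ext z; rw [← Finset.mul_sum, sum_coneWeight, mul_one]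
    have hd : ∀ j ∈ Finset.univ, DifferentiableAt ℝ (fun z => θ z * coneWeight j z) z :=
      fun j _ => ((ht j).1.differentiable (by simp)).differentiableAt
    have e4 : dbar θ z = ∑ j, dbar (fun z => θ z * coneWeight j z) z := by
      conv_lhs => rw [e3]
      simp only [dbar]
      rw [fderiv_fun_sum hd]
      simp only [sum_apply, Finset.mul_sum, ← Finset.sum_add_distrib,
        Finset.sum_div]
    rw [e4, Finset.mul_sum]
  simp_rw [e1, e2]
  rw [integral_finsetSum _ fun j _ => hw j _ (ht j), integral_finsetSum _ fun j _ =>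
    integrable_mul_of_memLp_two hu (continuous_dbar (ht j).1) (hasCompactSupport_dbar (ht j).2.1),
    ← Finset.sum_neg_distrib]
  exact Finset.sum_congr rfl fun j _ => h j _ (ht j)

/-! ### The covering of the domain -/

lemma isOpenMap_unitsExp : IsOpenMap fun s : ℂ => Units.mk0 (exp s) (exp_ne_zero s) :=
  (Units.isOpenEmbedding_val (R := ℂ)).isOpenMap_iff.2 isOpenMap_exp

lemma isOpenMap_cover (β : ℝ) : IsOpenMap (cover β) :=
  OnePoint.isOpenMap_coe.prodMap (QuotientGroup.isOpenMap_coe.comp isOpenMap_unitsExp)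

lemma isOpen_coverDomain : IsOpen coverDomain :=
  isOpen_lt continuous_const (by fun_prop)

lemma image_cover_coverDomain (β : ℝ) : cover β '' coverDomain = domain β := by
  refine Set.Subset.antisymm ?_ ?_
  · rintro _ ⟨y, hy, rfl⟩
    rwa [← Set.mem_preimage, cover_preimage_domain]
  · rintro _ ⟨z, w, rfl, h⟩
    refine ⟨(z, log w), ?_, ?_⟩
    · simpa [coverDomain, exp_log w.ne_zero] using h
    · have : Units.mk0 (exp (log (w : ℂ))) (exp_ne_zero _) = w :=
        Units.ext (exp_log w.ne_zero)
      simp only [cover, this]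
      rfl

lemma isOpen_domain (β : ℝ) : IsOpen (domain β) :=
  image_cover_coverDomain β ▸ isOpenMap_cover β _ isOpen_coverDomain

@[simp] lemma coordZ_cover (β : ℝ) (y : ℂ × ℂ) : coordZ (cover β y) = y.1 := rfl

/-- The default value at infinity may break continuity, but it only adds a closed fibre to an open
preimage. -/
lemma measurable_coordZ (β : ℝ) : Measurable (coordZ : Surf β → ℂ) := by
  have hfst : Continuous fun x : Surf β => x.1 := continuous_fst
  refine measurable_of_isOpen fun U hU => ?_
  have e : (coordZ : Surf β → ℂ) ⁻¹' U = (fun x : Surf β => x.1) ⁻¹' ((↑) '' U) ∪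
      {x | x.1 = OnePoint.infty ∧ (0 : ℂ) ∈ U} := by
    ext ⟨p, q⟩
    change OnePoint.elim p 0 id ∈ U ↔ p ∈ (↑) '' U ∨ p = OnePoint.infty ∧ (0 : ℂ) ∈ U
    induction p using OnePoint.rec with
    | infty => simp
    | coe z => simp
  rw [e]
  refine ((OnePoint.isOpenMap_coe U hU).preimage hfst).measurableSet.union ?_
  exact ((isClosed_singleton (x := OnePoint.infty)).preimage hfst).measurableSet.inter
    (MeasurableSet.const _)

lemma measurableSet_fundDomain (β : ℝ) : MeasurableSet (fundDomain β) := by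
  have h1 : Measurable fun y : ℂ × ℂ => y.2.re := by fun_prop
  have h2 : Measurable fun y : ℂ × ℂ => y.2.im := by fun_prop
  exact (h1 measurableSet_Ico).inter (h2 measurableSet_Ico)

/-- The density of the volume in the coordinates `(z, s)`. -/
def density (z : ℂ) : ℝ := ((1 + ‖z‖ ^ 2) ^ 2)⁻¹

lemma density_pos (z : ℂ) : 0 < density z := by unfold density; positivity

lemma continuous_density : Continuous density :=
  Continuous.inv₀ (by fun_prop) fun z => by positivity

/-- A fundamental domain for the covering of the domain. -/
def sheet (β : ℝ) : Set (ℂ × ℂ) := fundDomain β ∩ coverDomain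

lemma measurableSet_sheet (β : ℝ) : MeasurableSet (sheet β) :=
  (measurableSet_fundDomain β).inter isOpen_coverDomain.measurableSet

/-- The volume of the domain in the coordinates `(z, s)`. -/
def sheetVolume (β : ℝ) : Measure (ℂ × ℂ) :=
  ((volume : Measure (ℂ × ℂ)).restrict (sheet β)).withDensity
    fun y => ENNReal.ofReal (density y.1)

lemma measurable_ofReal_density : Measurable fun y : ℂ × ℂ => ENNReal.ofReal (density y.1) :=
  (continuous_density.measurable.comp measurable_fst).ennreal_ofReal

lemma domVolume_eq_map (β : ℝ) : domVolume β = (sheetVolume β).map (cover β) := by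
  rw [domVolume, surfVolume, Measure.restrict_map (continuous_cover β).measurable
    (isOpen_domain β).measurableSet, cover_preimage_domain, restrict_withDensity
    isOpen_coverDomain.measurableSet, Measure.restrict_restrict isOpen_coverDomain.measurableSet,
    Set.inter_comm]
  rfl

/-! ### Deck translations and transfer between the sheet and the covering -/

/-- The deck translation that belongs to a pair of integers. -/
def deck (β : ℝ) (k : ℤ × ℤ) : ℂ × ℂ :=
  (0, ((2 * Real.pi * β * k.1 : ℝ) : ℂ) + ((2 * Real.pi * k.2 : ℝ) : ℂ) * I)

lemma cover_add_deck (β : ℝ) (k : ℤ × ℤ) (y : ℂ × ℂ) : cover β (y + deck β k) = cover β y := by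
  have e : exp (y.2 + (deck β k).2) = exp y.2 * exp ((2 * Real.pi * β : ℝ) : ℂ) ^ k.1 := by
    rw [deck, exp_add, exp_add, ← exp_int_mul]
    have : exp (((2 * Real.pi * k.2 : ℝ) : ℂ) * I) = 1 := by
      rw [exp_eq_one_iff]
      exact ⟨k.2, by push_cast; ring⟩
    rw [this, mul_one]
    congr 2
    push_cast; ring
  refine Prod.ext (by simp [cover, deck]) ?_
  refine (QuotientGroup.eq.2 ?_).symm
  refine Subgroup.mem_zpowers_iff.2 ⟨k.1, Units.ext ?_⟩
  simp only [Units.val_mul, Units.val_zpow_eq_zpow_val, Units.val_mk0, Units.val_inv_eq_inv_val,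
    Prod.snd_add, e]
  rw [inv_mul_cancel_left₀ (exp_ne_zero _)]

lemma mem_coverDomain_add_deck (β : ℝ) (k : ℤ × ℤ) (y : ℂ × ℂ) :
    y + deck β k ∈ coverDomain ↔ y ∈ coverDomain := by
  rw [← cover_preimage_domain β, Set.mem_preimage, Set.mem_preimage, cover_add_deck]

lemma measurePreserving_add_deck (β : ℝ) (k : ℤ × ℤ) :
    MeasurePreserving (fun y => y + deck β k) (volume : Measure (ℂ × ℂ)) volume := by
  have e : (fun y => y + deck β k) = Prod.map id (· + (deck β k).2) := by
    funext y
    exact Prod.ext (add_zero _) rfl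
  rw [e]
  exact (MeasurePreserving.id volume).prod (measurePreserving_add_right volume (deck β k).2)

/-- The index of the translate of the fundamental domain that contains a point. -/
def deckIndex (β : ℝ) (y : ℂ × ℂ) : ℤ × ℤ :=
  (-⌊y.2.re / (2 * Real.pi * β)⌋, -⌊y.2.im / (2 * Real.pi)⌋)

lemma sub_mul_floor_mem_Ico {p : ℝ} (hp : 0 < p) (x : ℝ) : x + p * -⌊x / p⌋ ∈ Set.Ico 0 p := by
  have h1 := Int.floor_le (x / p)
  have h2 := Int.lt_floor_add_one (x / p)
  rw [le_div_iff₀ hp] at h1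
  rw [div_lt_iff₀ hp] at h2
  constructor <;> linarith

lemma add_deckIndex_mem {β : ℝ} (hβ : 0 < β) (y : ℂ × ℂ) :
    y + deck β (deckIndex β y) ∈ fundDomain β := by
  have h1 := sub_mul_floor_mem_Ico (p := 2 * Real.pi * β) (by positivity) y.2.re
  have h2 := sub_mul_floor_mem_Ico (p := 2 * Real.pi) (by positivity) y.2.im
  constructor
  · simpa [deck, deckIndex] using h1
  · simpa [deck, deckIndex] using h2

/-- Countably many deck translates of the sheet cover `coverDomain`, and translations preserve null
sets. -/
lemma ae_coverDomain_of_ae_sheet {β : ℝ} (hβ : 0 < β) {P : Surf β → Prop}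
    (h : ∀ᵐ y, y ∈ sheet β → P (cover β y)) : ∀ᵐ y, y ∈ coverDomain → P (cover β y) := by
  have h2 : ∀ᵐ y : ℂ × ℂ, ∀ k : ℤ × ℤ, y + deck β k ∈ sheet β → P (cover β (y + deck β k)) :=
    ae_all_iff.2 fun k =>
      (measurePreserving_add_deck β k).quasiMeasurePreserving.ae h
  filter_upwards [h2] with y hy hyc
  have := hy (deckIndex β y) ⟨add_deckIndex_mem hβ y, (mem_coverDomain_add_deck _ _ _).2 hyc⟩
  rwa [cover_add_deck] at this

lemma ae_sheetVolume_iff (β : ℝ) {P : ℂ × ℂ → Prop} :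
    (∀ᵐ y ∂sheetVolume β, P y) ↔ ∀ᵐ y, y ∈ sheet β → P y := by
  rw [sheetVolume, ae_withDensity_iff measurable_ofReal_density,
    ae_restrict_iff' (measurableSet_sheet β)]
  simp only [ne_eq, ENNReal.ofReal_eq_zero, not_le, density_pos, true_imp_iff]

lemma ae_coverDomain_of_ae {β : ℝ} (hβ : 0 < β) {P : Surf β → Prop}
    (h : ∀ᵐ x ∂domVolume β, P x) : ∀ᵐ y, y ∈ coverDomain → P (cover β y) := by
  rw [domVolume_eq_map] at h
  exact ae_coverDomain_of_ae_sheet hβ ((ae_sheetVolume_iff β).1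
    (ae_of_ae_map (continuous_cover β).aemeasurable h))

lemma ae_domVolume_of_ae {β : ℝ} {P : Surf β → Prop} (hP : MeasurableSet {x | P x})
    (h : ∀ᵐ y, y ∈ coverDomain → P (cover β y)) : ∀ᵐ x ∂domVolume β, P x := by
  rw [domVolume_eq_map, ae_map_iff (continuous_cover β).aemeasurable hP, ae_sheetVolume_iff]
  filter_upwards [h] with y hy hs
  exact hy hs.2

/-- The volume density is bounded below where `|z| ≤ R`, so it can be divided out. -/
lemma integrableOn_sheet_of_integrable {β : ℝ} {F : Surf β → ℂ} (hF : Integrable F (domVolume β))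
    (R : ℝ) : IntegrableOn (fun y => F (cover β y)) (sheet β ∩ {y | ‖y.1‖ ≤ R}) := by
  rw [domVolume_eq_map] at hF
  have h1 := (integrable_map_measure hF.1 (continuous_cover β).aemeasurable).1 hF
  rw [sheetVolume, integrable_withDensity_iff_integrable_smul' measurable_ofReal_density
    (Eventually.of_forall fun _ => ENNReal.ofReal_lt_top)] at h1
  have hm : MeasurableSet {y : ℂ × ℂ | ‖y.1‖ ≤ R} :=
    (isClosed_le (by fun_prop) continuous_const).measurableSet
  have h2 : IntegrableOn (fun y => (density y.1) • F (cover β y))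
      (sheet β ∩ {y | ‖y.1‖ ≤ R}) := by
    refine IntegrableOn.mono_set (IntegrableOn.congr_fun h1 (fun y _ => ?_)
      (measurableSet_sheet β)) Set.inter_subset_left
    simp [ENNReal.toReal_ofReal (density_pos _).le]
  have h3 : IntegrableOn (fun y => ((1 + ‖y.1‖ ^ 2) ^ 2) • ((density y.1) • F (cover β y)))
      (sheet β ∩ {y | ‖y.1‖ ≤ R}) := by
    refine Integrable.bdd_smul (φ := fun y : ℂ × ℂ => (1 + ‖y.1‖ ^ 2) ^ 2) h2 ((1 + R ^ 2) ^ 2) ?_ ?_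
    · exact Continuous.aestronglyMeasurable (by fun_prop)
    · refine (ae_restrict_iff' ((measurableSet_sheet β).inter hm)).2
        (Eventually.of_forall fun y hy => ?_)
      rw [Real.norm_of_nonneg (by positivity)]
      have : ‖y.1‖ ≤ R := hy.2
      gcongr
  refine h3.congr_fun (fun y _ => ?_) ((measurableSet_sheet β).inter hm)
  beta_reduce
  have : (1 + ‖y.1‖ ^ 2) ≠ 0 := by positivity
  rw [smul_smul, density, mul_inv_cancel₀ (by positivity), one_smul]

/-- The pull-back of an integrable function is locally integrable. -/
lemma locallyIntegrableOn_comp_cover {β : ℝ} (hβ : 0 < β) {F : Surf β → ℂ}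
    (hF : Integrable F (domVolume β)) :
    LocallyIntegrableOn (fun y => F (cover β y)) coverDomain := by
  rw [locallyIntegrableOn_iff isOpen_coverDomain.isLocallyClosed]
  intro K hK hKc
  obtain ⟨R, hR⟩ := hKc.isBounded.exists_norm_le
  have hp : 0 < 2 * Real.pi * β := by positivity
  -- All deck indices of points of norm at most `R`; the endpoints swap because `deckIndex` negates
  -- the floor.
  let J : Set (ℤ × ℤ) := Set.Icc (-⌊R / (2 * Real.pi * β)⌋) (-⌊-R / (2 * Real.pi * β)⌋) ×ˢ
    Set.Icc (-⌊R / (2 * Real.pi)⌋) (-⌊-R / (2 * Real.pi)⌋)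
  have hJ : J.Finite := (Set.finite_Icc _ _).prod (Set.finite_Icc _ _)
  have hcov : K ⊆ ⋃ k ∈ J, (fun y => y + deck β k) ⁻¹' (sheet β ∩ {y | ‖y.1‖ ≤ R}) := by
    intro y hy
    have hyR := hR y hy
    have h2 : ‖y.2‖ ≤ R := (norm_snd_le y).trans hyR
    have hre := abs_le.1 ((abs_re_le_norm y.2).trans h2)
    have him := abs_le.1 ((abs_im_le_norm y.2).trans h2)
    refine Set.mem_biUnion (x := deckIndex β y) ⟨⟨?_, ?_⟩, ⟨?_, ?_⟩⟩ ?_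
    · exact neg_le_neg (Int.floor_le_floor (by gcongr; exact hre.2))
    · exact neg_le_neg (Int.floor_le_floor (by gcongr; exact hre.1))
    · exact neg_le_neg (Int.floor_le_floor (by gcongr; exact him.2))
    · exact neg_le_neg (Int.floor_le_floor (by gcongr; exact him.1))
    · refine ⟨⟨add_deckIndex_mem hβ y, (mem_coverDomain_add_deck _ _ _).2 (hK hy)⟩, ?_⟩
      simpa [deck] using (norm_fst_le y).trans hyR
  refine IntegrableOn.mono_set ((integrableOn_finite_biUnion hJ).2 fun k _ => ?_) hcov
  have := ((measurePreserving_add_deck β k).integrableOn_comp_preimage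
    (MeasurableEquiv.addRight (deck β k)).measurableEmbedding
    (f := fun y => F (cover β y))).2 (integrableOn_sheet_of_integrable hF R)
  refine this.congr_fun_ae (Eventually.of_forall fun y => ?_)
  simp [cover_add_deck]

/-! ### The push-forward of the volume to the plane -/

lemma volume_reProdIm (s t : Set ℝ) : volume (s ×ℂ t) = volume s * volume t := by
  have e : s ×ℂ t = measurableEquivRealProd ⁻¹' (s ×ˢ t) := by
    ext z; simp [mem_reProdIm, measurableEquivRealProd_apply]
  rw [e, volume_preserving_equiv_real_prod.measure_preimage_equiv, Measure.volume_eq_prod,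
    Measure.prod_prod]

/-- Both sides integrate a `2π`-periodic indicator over a full period. -/
lemma volume_cos_pos (a : ℝ) : volume {t ∈ Set.Ico 0 (2 * Real.pi) | 0 < Real.cos (a + t)} =
    volume {t ∈ Set.Ico 0 (2 * Real.pi) | 0 < Real.cos t} := by
  have hm : ∀ b : ℝ, MeasurableSet {t | 0 < Real.cos (b + t)} := fun b =>
    (isOpen_lt continuous_const (by fun_prop)).measurableSet
  have key : ∀ b : ℝ, volume.real {t ∈ Set.Ico 0 (2 * Real.pi) | 0 < Real.cos (b + t)} =
      ∫ t in b..b + 2 * Real.pi, {t | 0 < Real.cos t}.indicator (fun _ => (1 : ℝ)) t := by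
    intro b
    have := intervalIntegral.integral_comp_add_left (a := 0) (b := 2 * Real.pi)
      ({t | 0 < Real.cos t}.indicator (fun _ => (1 : ℝ))) b
    rw [add_zero] at this
    rw [← this, intervalIntegral.integral_of_le Real.two_pi_pos.le, ← integral_Ico_eq_integral_Ioc]
    have e : (fun t => {t | 0 < Real.cos t}.indicator (fun _ => (1 : ℝ)) (b + t)) =
        {t | 0 < Real.cos (b + t)}.indicator fun _ => (1 : ℝ) := by
      ext t; simp [Set.indicator]
    rw [e, setIntegral_indicator (hm b)]
    simp [Set.inter_def]
  have hper : Function.Periodic ({t | 0 < Real.cos t}.indicator (fun _ => (1 : ℝ)))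
      (2 * Real.pi) := fun t => by simp [Set.indicator]
  have hfin : ∀ b : ℝ, volume {t ∈ Set.Ico 0 (2 * Real.pi) | 0 < Real.cos (b + t)} ≠ ⊤ := fun b =>
    measure_ne_top_of_subset (Set.sep_subset _ _) measure_Ico_lt_top.ne
  have := (ENNReal.toReal_eq_toReal_iff' (hfin a) (hfin 0)).1
    (by have h := key a; rw [hper.intervalIntegral_add_eq a 0, ← key 0] at h; exact h)
  simpa using this

/-- The volume of the fibres of the domain over the plane. -/
def fiberVolume (β : ℝ) : ENNReal := volume (Set.Ico 0 (2 * Real.pi * β)) *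
  volume {t ∈ Set.Ico 0 (2 * Real.pi) | 0 < Real.cos t}

lemma fiberVolume_ne_zero {β : ℝ} (hβ : 0 < β) : fiberVolume β ≠ 0 := by
  refine mul_ne_zero ?_ ?_
  · simp [Real.pi_pos, hβ]
  · have hsub : Set.Ioo 0 (Real.pi / 2) ⊆ {t ∈ Set.Ico 0 (2 * Real.pi) | 0 < Real.cos t} :=
      fun t ht => ⟨⟨ht.1.le, by linarith [ht.2, Real.pi_pos]⟩,
        Real.cos_pos_of_mem_Ioo ⟨by linarith [ht.1, Real.pi_pos], ht.2⟩⟩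
    refine fun h => ?_
    have := measure_mono_null hsub h
    simp at this
    linarith [Real.pi_pos]

lemma fiberVolume_ne_top (β : ℝ) : fiberVolume β ≠ ⊤ :=
  ENNReal.mul_ne_top (by simp) (measure_ne_top_of_subset (Set.sep_subset _ _) measure_Ico_lt_top.ne)

/-- In polar form the sign of `Re (z exp s)` is that of `cos (arg z + Im s)`, so `z` only rotates
the slice. At `z = 0` the slice is empty. -/
lemma volume_slice_sheet (β : ℝ) {z : ℂ} (hz : z ≠ 0) :
    volume (Prod.mk z ⁻¹' sheet β) = fiberVolume β := by
  have e : Prod.mk z ⁻¹' sheet β = Set.Ico 0 (2 * Real.pi * β) ×ℂ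
      {t ∈ Set.Ico 0 (2 * Real.pi) | 0 < Real.cos (arg z + t)} := by
    ext s
    have hre : (z * exp s).re = (‖z‖ * Real.exp s.re) * Real.cos (arg z + s.im) := by
      conv_lhs => rw [← norm_mul_exp_arg_mul_I z, mul_assoc, ← exp_add, re_ofReal_mul, exp_re]
      simp
      ring
    have hp : 0 < ‖z‖ * Real.exp s.re := mul_pos (norm_pos_iff.2 hz) (Real.exp_pos _)
    simp only [Set.mem_preimage, sheet, fundDomain, coverDomain, mem_reProdIm, Set.mem_inter_iff,
      Set.mem_ofPred_eq, hre, mul_pos_iff_of_pos_left hp, and_assoc]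
  rw [e, volume_reProdIm, volume_cos_pos, fiberVolume]

/-- The push-forward of the volume of the domain under `z`. -/
lemma map_coordZ_domVolume (β : ℝ) : (domVolume β).map coordZ =
    fiberVolume β • (volume : Measure ℂ).withDensity fun z => ENNReal.ofReal (density z) := by
  ext A hA
  have hd : Measurable fun z => ENNReal.ofReal (density z) :=
    continuous_density.measurable.ennreal_ofReal
  have hc : Measurable (coordZ ∘ cover β) := measurable_fst
  rw [domVolume_eq_map, Measure.map_map (measurable_coordZ β) (continuous_cover β).measurable,
    Measure.map_apply hc hA, Measure.smul_apply, withDensity_apply _ hA, sheetVolume,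
    withDensity_apply _ (hc hA), Measure.restrict_restrict (hc hA), smul_eq_mul,
    ← lintegral_indicator ((hc hA).inter (measurableSet_sheet β)), Measure.volume_eq_prod,
    lintegral_prod _ (measurable_ofReal_density.indicator
      ((hc hA).inter (measurableSet_sheet β))).aemeasurable,
    ← lintegral_const_mul _ hd, ← lintegral_indicator hA]
  refine lintegral_congr_ae ?_
  filter_upwards [compl_mem_ae_iff.2 (measure_singleton (0 : ℂ))] with z hz
  by_cases hzA : z ∈ A
  · have e : ∀ s : ℂ, ((coordZ ∘ cover β ⁻¹' A) ∩ sheet β).indicator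
        (fun y : ℂ × ℂ => ENNReal.ofReal (density y.1)) (z, s) =
        (Prod.mk z ⁻¹' sheet β).indicator (fun _ => ENNReal.ofReal (density z)) s := fun s => by
      by_cases hs : (z, s) ∈ sheet β <;> simp [Set.indicator, hs, hzA]
    simp_rw [e]
    rw [Set.indicator_of_mem hzA,
      lintegral_indicator_const (measurable_prodMk_left (measurableSet_sheet β)),
      volume_slice_sheet β hz, mul_comm]
  · simp [Set.indicator, hzA]

lemma integral_comp_coordZ (β : ℝ) {F : ℂ → ℂ} (hF : Measurable F) :
    ∫ x, F (coordZ x) ∂domVolume β = (fiberVolume β).toReal • ∫ z, density z • F z := by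
  have hd : Measurable fun z => ENNReal.ofReal (density z) :=
    continuous_density.measurable.ennreal_ofReal
  rw [← integral_map (measurable_coordZ β).aemeasurable hF.aestronglyMeasurable,
    map_coordZ_domVolume, integral_smul_measure,
    integral_withDensity_eq_integral_toReal_smul hd
      (Eventually.of_forall fun _ => ENNReal.ofReal_lt_top)]
  simp only [ENNReal.toReal_ofReal (density_pos _).le]

/-- The push-forward density is a finite nonzero constant times `(1 + |z|²)⁻²`, whose square root is
absorbed into the function. -/
lemma memLp_comp_coordZ_iff {β : ℝ} (hβ : 0 < β) {F : ℂ → ℂ} (hF : Measurable F) :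
    MemLp (fun x => F (coordZ x)) 2 (domVolume β) ↔
      MemLp (fun z => (((1 + ‖z‖ ^ 2)⁻¹ : ℝ) : ℂ) * F z) 2 volume := by
  have hd : Measurable fun z => ENNReal.ofReal (density z) :=
    continuous_density.measurable.ennreal_ofReal
  have hw : Measurable fun z : ℂ => (((1 + ‖z‖ ^ 2)⁻¹ : ℝ) : ℂ) * F z := by fun_prop
  have h1 : MemLp (fun x => F (coordZ x)) 2 (domVolume β) ↔
      MemLp F 2 ((domVolume β).map coordZ) :=
    (memLp_map_measure_iff hF.aestronglyMeasurable (measurable_coordZ β).aemeasurable).symm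
  rw [h1, memLp_two_iff_integrable_sq_norm hF.aestronglyMeasurable,
    memLp_two_iff_integrable_sq_norm hw.aestronglyMeasurable, map_coordZ_domVolume,
    integrable_smul_measure (fiberVolume_ne_zero hβ) (fiberVolume_ne_top β),
    integrable_withDensity_iff_integrable_smul' hd
      (Eventually.of_forall fun _ => ENNReal.ofReal_lt_top)]
  refine integrable_congr (Eventually.of_forall fun z => ?_)
  simp only [ENNReal.toReal_ofReal (density_pos _).le]
  rw [norm_mul, norm_real, Real.norm_of_nonneg (by positivity), mul_pow, density, inv_pow,
    smul_eq_mul]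

/-! ### Test functions on the covering and their slices -/

lemma integrable_mul_of_integrableOn_tsupport {X : Type*} [TopologicalSpace X] [T2Space X]
    [MeasurableSpace X] [OpensMeasurableSpace X] {μ : Measure X} {h f : X → ℂ}
    (hh : Continuous h) (hc : HasCompactSupport h) (hf : IntegrableOn f (tsupport h) μ) :
    Integrable (fun x => h x * f x) μ := by
  refine (integrableOn_iff_integrable_of_support_subset (s := tsupport h) ?_).1
    (hf.continuousOn_mul hh.continuousOn hc)
  exact fun x hx => subset_tsupport _ (left_ne_zero_of_mul (a := h x) (b := f x) hx)

lemma fst_ne_zero_of_mem_coverDomain {y : ℂ × ℂ} (h : y ∈ coverDomain) : y.1 ∈ ({0}ᶜ : Set ℂ) := by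
  rintro h0
  have h0 : y.1 = 0 := h0
  simp [coverDomain, h0] at h

/-- A compact set lies in the product of its projections; the first avoids the origin and the second
has finite volume. -/
lemma locallyIntegrableOn_comp_fst {f : ℂ → ℂ} (hf : LocallyIntegrableOn f {0}ᶜ) :
    LocallyIntegrableOn (fun y : ℂ × ℂ => f y.1) coverDomain := by
  rw [locallyIntegrableOn_iff isOpen_coverDomain.isLocallyClosed]
  intro K hK hKc
  have h1 : IsCompact (Prod.fst '' K) := hKc.image continuous_fst
  have h2 : IsCompact (Prod.snd '' K) := hKc.image continuous_snd
  have h3 : IntegrableOn f (Prod.fst '' K) := by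
    refine hf.integrableOn_compact_subset ?_ h1
    rintro _ ⟨y, hy, rfl⟩
    exact fst_ne_zero_of_mem_coverDomain (hK hy)
  have : IsFiniteMeasure (volume.restrict (Prod.snd '' K)) :=
    ⟨by rw [Measure.restrict_apply_univ]; exact h2.measure_lt_top⟩
  refine IntegrableOn.mono_set (t := (Prod.fst '' K) ×ˢ (Prod.snd '' K)) ?_
    Set.subset_fst_image_prod_snd_image
  rw [IntegrableOn, Measure.volume_eq_prod, ← Measure.prod_restrict]
  exact Integrable.comp_fst h3 _

lemma isClosed_slice_tsupport (χ : ℂ × ℂ → ℂ) (s : ℂ) : IsClosed {z : ℂ | (z, s) ∈ tsupport χ} :=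
  (isClosed_tsupport χ).preimage (by fun_prop)

lemma isPlaneTest_slice_left {χ : ℂ × ℂ → ℂ} (hχ : IsTest χ) (s : ℂ) :
    IsPlaneTest {0}ᶜ fun z => χ (z, s) := by
  have hsub : tsupport (fun z => χ (z, s)) ⊆ {z : ℂ | (z, s) ∈ tsupport χ} :=
    closure_minimal (fun z hz => subset_tsupport χ hz) (isClosed_slice_tsupport χ s)
  refine ⟨hχ.1.comp (by fun_prop), ?_, fun z hz =>
    fst_ne_zero_of_mem_coverDomain (hχ.2.2 (hsub hz))⟩
  refine HasCompactSupport.intro (hχ.2.1.isCompact.image continuous_fst) fun z hz => ?_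
  by_contra h
  exact hz ⟨(z, s), subset_tsupport χ h, rfl⟩

lemma isPlaneTest_slice_right {χ : ℂ × ℂ → ℂ} (hχ : IsTest χ) (z : ℂ) :
    IsPlaneTest Set.univ fun s => χ (z, s) := by
  refine ⟨hχ.1.comp (by fun_prop), ?_, Set.subset_univ _⟩
  refine HasCompactSupport.intro (hχ.2.1.isCompact.image continuous_snd) fun s hs => ?_
  by_contra h
  exact hs ⟨(z, s), subset_tsupport χ h, rfl⟩

lemma dbar_slice_left {χ : ℂ × ℂ → ℂ} (hχ : ContDiff ℝ ∞ χ) (z s : ℂ) :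
    dbar (fun z => χ (z, s)) z = dbarDir χ (z, s) (1, 0) := by
  have h1 : HasFDerivAt (fun z => χ (z, s)) _ z :=
    ((hχ.differentiable (by simp)) (z, s)).hasFDerivAt.comp z (hasFDerivAt_prodMk_left z s)
  simp [dbar, dbarDir, h1.fderiv]

lemma dbar_slice_right {χ : ℂ × ℂ → ℂ} (hχ : ContDiff ℝ ∞ χ) (z s : ℂ) :
    dbar (fun s => χ (z, s)) s = dbarDir χ (z, s) (0, 1) := by
  have h1 : HasFDerivAt (fun s => χ (z, s)) _ s :=
    ((hχ.differentiable (by simp)) (z, s)).hasFDerivAt.comp s (hasFDerivAt_prodMk_right z s)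
  simp [dbar, dbarDir, h1.fderiv]

lemma continuous_dbarDir {χ : ℂ × ℂ → ℂ} (h : ContDiff ℝ ∞ χ) (v : ℂ × ℂ) :
    Continuous fun y => dbarDir χ y v := by
  have := h.continuous_fderiv (by simp)
  unfold dbarDir
  fun_prop

lemma tsupport_dbarDir_subset (χ : ℂ × ℂ → ℂ) (v : ℂ × ℂ) :
    tsupport (fun y => dbarDir χ y v) ⊆ tsupport χ := by
  refine closure_minimal (fun z hz => ?_) (isClosed_tsupport _)
  by_contra h
  have : fderiv ℝ χ z = 0 := by
    by_contra h0
    exact h (support_fderiv_subset ℝ h0)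
  exact hz (by simp [dbarDir, this])

lemma hasCompactSupport_dbarDir {χ : ℂ × ℂ → ℂ} (h : HasCompactSupport χ) (v : ℂ × ℂ) :
    HasCompactSupport fun y => dbarDir χ y v :=
  h.mono' ((subset_tsupport _).trans (tsupport_dbarDir_subset χ v))

lemma dbarDir_eq (χ : ℂ × ℂ → ℂ) (y v : ℂ × ℂ) :
    dbarDir χ y v = conj v.1 * dbarDir χ y (1, 0) + conj v.2 * dbarDir χ y (0, 1) := by
  set L := fderiv ℝ χ y
  have key : ∀ w : ℂ × ℂ, L w =
      w.1.re * L (1, 0) + w.1.im * L (I, 0) + w.2.re * L (0, 1) + w.2.im * L (0, I) := by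
    intro w
    have e : w = w.1.re • ((1 : ℂ), (0 : ℂ)) + w.1.im • (I, (0 : ℂ)) + w.2.re • ((0 : ℂ), (1 : ℂ))
        + w.2.im • ((0 : ℂ), I) := by
      refine Prod.ext ?_ ?_ <;> simp [re_add_im]
    conv_lhs => rw [e]
    simp only [map_add, map_smul, real_smul]
  have c1 : conj v.1 = v.1.re - v.1.im * I := by
    apply Complex.ext <;> simp
  have c2 : conj v.2 = v.2.re - v.2.im * I := by
    apply Complex.ext <;> simp
  simp only [dbarDir]
  rw [key v, key (I • v), c1, c2]
  simp
  ring_nf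
  simp only [I_sq]
  ring

lemma integral_dbar_eq_zero {θ : ℂ → ℂ} (h : IsPlaneTest Set.univ θ) : ∫ z, dbar θ z = 0 := by
  have hc := h.1.continuous_fderiv (by simp)
  have hint : ∀ m : ℂ, Integrable fun z => fderiv ℝ θ z m := fun m =>
    Continuous.integrable_of_hasCompactSupport (by fun_prop)
      (h.2.1.fderiv_apply ℝ m)
  have h0 : ∀ m : ℂ, ∫ z, fderiv ℝ θ z m = 0 := fun m => by
    have := integral_mul_fderiv_eq_neg_fderiv_mul_of_integrable (μ := (volume : Measure ℂ))
      (f := fun _ => (1 : ℂ)) (g := θ) (v := m) (by simp) (by simpa using hint m)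
      (by simpa using h.1.continuous.integrable_of_hasCompactSupport h.2.1)
      (by simp) (fun z _ => (h.1.differentiable (by simp)) z)
    simpa using this
  simp only [dbar]
  rw [integral_div, integral_add (hint 1) ((hint I).const_mul I), integral_const_mul, h0, h0]
  simp

/-- By Fubini `u` is constant along `s`, and a compactly supported `∂/∂s̄` derivative integrates to
zero. This removes the `ψ̄` component of `∂̄ f`. -/
lemma integral_mul_dbarDir_snd {χ : ℂ × ℂ → ℂ} {u : ℂ → ℂ} (hχ : IsTest χ)
    (hu : LocallyIntegrableOn u {0}ᶜ) : ∫ y, u y.1 * dbarDir χ y (0, 1) = 0 := by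
  have hint : Integrable fun y : ℂ × ℂ => dbarDir χ y (0, 1) * u y.1 := by
    refine integrable_mul_of_integrableOn_tsupport (continuous_dbarDir hχ.1 _)
      (hasCompactSupport_dbarDir hχ.2.1 _) ?_
    exact (locallyIntegrableOn_comp_fst hu).integrableOn_compact_subset
      ((tsupport_dbarDir_subset χ _).trans hχ.2.2) (hasCompactSupport_dbarDir hχ.2.1 _)
  simp_rw [mul_comm (u _)]
  rw [Measure.volume_eq_prod] at hint ⊢
  rw [integral_prod _ hint]
  simp_rw [← dbar_slice_right hχ.1, integral_mul_const,
    integral_dbar_eq_zero (isPlaneTest_slice_right hχ _), zero_mul, integral_zero]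

/-- Functions of `z` alone that satisfy the Cauchy–Riemann equation on the punctured plane satisfy
it on the covering of the domain. -/
lemma WeakDbarOn.integral_cover {χ : ℂ × ℂ → ℂ} {u v : ℂ → ℂ} (hχ : IsTest χ)
    (hu : LocallyIntegrableOn u {0}ᶜ) (hv : LocallyIntegrableOn v {0}ᶜ)
    (h : WeakDbarOn {0}ᶜ u v) :
    ∫ y, χ y * v y.1 = -∫ y, u y.1 * dbarDir χ y (1, 0) := by
  have hi1 : Integrable fun y : ℂ × ℂ => dbarDir χ y (1, 0) * u y.1 := by
    refine integrable_mul_of_integrableOn_tsupport (continuous_dbarDir hχ.1 _)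
      (hasCompactSupport_dbarDir hχ.2.1 _) ?_
    exact (locallyIntegrableOn_comp_fst hu).integrableOn_compact_subset
      ((tsupport_dbarDir_subset χ _).trans hχ.2.2) (hasCompactSupport_dbarDir hχ.2.1 _)
  have hi2 : Integrable fun y : ℂ × ℂ => χ y * v y.1 := by
    refine integrable_mul_of_integrableOn_tsupport hχ.1.continuous hχ.2.1 ?_
    exact (locallyIntegrableOn_comp_fst hv).integrableOn_compact_subset hχ.2.2 hχ.2.1
  simp_rw [mul_comm (u _)]
  rw [Measure.volume_eq_prod] at hi1 hi2 ⊢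
  -- Integrating in `z` first makes each slice a test function on the punctured plane.
  rw [integral_prod_symm _ hi1, integral_prod_symm _ hi2, ← integral_neg]
  refine integral_congr_ae (Eventually.of_forall fun s => ?_)
  have := h _ (isPlaneTest_slice_left hχ s)
  simp_rw [dbar_slice_left hχ.1, mul_comm (u _)] at this
  exact this

/-! ### Averaging over the fibres -/

/-- The complex number that maps the cone into the right half plane by multiplication. -/
def coneDir (j : Bool × Bool) : ℂ := ⟨sgn j.1, -sgn j.2⟩

lemma coneDir_ne_zero (j : Bool × Bool) : coneDir j ≠ 0 := by
  intro h
  have := congrArg re h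
  rcases j with ⟨_ | _, b⟩ <;> simp [coneDir, sgn] at this

/-- Let `x, y ≥ -|z|/8` be the signed coordinates. If `x + y < |z|/2`, both are below `5|z|/8`, so
`x² + y² ≤ (50/64) |z|²`, which is impossible. -/
lemma norm_le_re_mul_coneDir {j : Bool × Bool} {z : ℂ} (hz : z ∈ cone j) :
    ‖z‖ / 2 ≤ (z * coneDir j).re := by
  obtain ⟨-, h1, h2⟩ := hz
  have hn : ‖z‖ ^ 2 = (sgn j.1 * z.re) ^ 2 + (sgn j.2 * z.im) ^ 2 := by
    rw [← normSq_eq_norm_sq, normSq_apply]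
    rcases j with ⟨_ | _, _ | _⟩ <;> simp [sgn] <;> ring
  have e : (z * coneDir j).re = sgn j.1 * z.re + sgn j.2 * z.im := by
    simp [coneDir]; ring
  rw [e]
  set x := sgn j.1 * z.re
  set y := sgn j.2 * z.im
  have h0 := norm_nonneg z
  by_contra hlt
  push Not at hlt
  have hx : x ≤ 5 / 8 * ‖z‖ := by linarith
  have hy : y ≤ 5 / 8 * ‖z‖ := by linarith
  have hx2 : x ^ 2 ≤ 25 / 64 * ‖z‖ ^ 2 := by nlinarith
  have hy2 : y ^ 2 ≤ 25 / 64 * ‖z‖ ^ 2 := by nlinarith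
  have hzz : ‖z‖ ^ 2 ≤ 0 := by nlinarith
  have : ‖z‖ = 0 := by nlinarith
  linarith

/-- Replacing `coneDir j` by `exp s` changes the real part by less than `|z|/4`, while it is at
least `|z|/2`. So one window in `s` serves the whole cone. -/
lemma mem_coverDomain_of_cone {j : Bool × Bool} {z s : ℂ} (hz : z ∈ cone j)
    (hs : ‖exp s - coneDir j‖ < 1 / 4) : (z, s) ∈ coverDomain := by
  have h1 := norm_le_re_mul_coneDir hz
  have hz0 : 0 < ‖z‖ := norm_pos_iff.2 hz.1
  have h2 : |(z * (exp s - coneDir j)).re| ≤ ‖z‖ * ‖exp s - coneDir j‖ := by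
    rw [← norm_mul]; exact abs_re_le_norm _
  have e : (z * exp s).re = (z * coneDir j).re + (z * (exp s - coneDir j)).re := by
    rw [← add_re]; congr 1; ring
  have h3 : ‖z‖ * ‖exp s - coneDir j‖ < ‖z‖ * (1 / 4) := by gcongr
  have := neg_abs_le (z * (exp s - coneDir j)).re
  change 0 < (z * exp s).re
  linarith

lemma exists_window (j : Bool × Bool) : ∃ η : ℂ → ℂ,
    IsPlaneTest {s | ‖exp s - coneDir j‖ < 1 / 4} η ∧ ∫ s, η s = 1 := by
  have hmem : {s | ‖exp s - coneDir j‖ < 1 / 4} ∈ 𝓝 (log (coneDir j)) := by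
    refine (isOpen_lt (by fun_prop) continuous_const).mem_nhds ?_
    simp [exp_log (coneDir_ne_zero j)]
  obtain ⟨r, hr, hsub⟩ := Metric.nhds_basis_closedBall.mem_iff.1 hmem
  let f : ContDiffBump (log (coneDir j)) := ⟨r / 2, r, by positivity, by linarith⟩
  refine ⟨fun s => (f.normed volume s : ℂ), ⟨ofRealCLM.contDiff.comp f.contDiff_normed,
    f.hasCompactSupport_normed.comp_left (g := ofReal) rfl, ?_⟩, ?_⟩
  · refine Set.Subset.trans ?_ hsub
    have h := f.tsupport_normed_eq (μ := (volume : Measure ℂ))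
    refine Set.Subset.trans (closure_mono fun s hs => ?_) h.le
    exact fun h0 => hs (by simp [h0])
  · have h := f.integral_normed (μ := (volume : Measure ℂ))
    exact (integral_ofReal (f := f.normed volume)).trans (by rw [h]; exact ofReal_one)

lemma dbarDir_mul_fst {θ η : ℂ → ℂ} (hθ : ContDiff ℝ ∞ θ) (hη : ContDiff ℝ ∞ η) (y : ℂ × ℂ) :
    dbarDir (fun y => θ y.1 * η y.2) y (1, 0) = dbar θ y.1 * η y.2 := by
  have hc : ContDiff ℝ ∞ fun y : ℂ × ℂ => θ y.1 * η y.2 := by fun_prop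
  rw [← dbar_slice_left hc y.1 y.2]
  have hd := hθ.differentiable (by simp)
  simp only [dbar]
  rw [fderiv_mul_const (hd y.1)]
  simp
  ring

lemma isTest_mul {j : Bool × Bool} {θ η : ℂ → ℂ} (hθ : IsPlaneTest (cone j) θ)
    (hη : IsPlaneTest {s | ‖exp s - coneDir j‖ < 1 / 4} η) : IsTest fun y => θ y.1 * η y.2 := by
  have hsub : tsupport (fun y : ℂ × ℂ => θ y.1 * η y.2) ⊆ tsupport θ ×ˢ tsupport η := by
    refine closure_minimal (fun y hy => ?_) ((isClosed_tsupport _).prod (isClosed_tsupport _))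
    exact ⟨subset_tsupport _ (left_ne_zero_of_mul (a := θ y.1) (b := η y.2) hy),
      subset_tsupport _ (right_ne_zero_of_mul (a := θ y.1) (b := η y.2) hy)⟩
  refine ⟨?_, ?_, fun y hy => mem_coverDomain_of_cone (hθ.2.2 (hsub hy).1) (hη.2.2 (hsub hy).2)⟩
  · exact (hθ.1.comp contDiff_fst).mul (hη.1.comp contDiff_snd)
  · exact (hθ.2.1.isCompact.prod hη.2.1.isCompact).of_isClosed_subset (isClosed_tsupport _) hsub

/-- Near `z` one tests with a bump equal to `1` on a ball of radius `|z|/4` and supported within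
radius `|z|/2`, away from the origin. -/
lemma locallyIntegrableOn_of_mul_test {v : ℂ → ℂ}
    (h : ∀ θ, IsPlaneTest {0}ᶜ θ → Integrable fun z => θ z * v z) :
    LocallyIntegrableOn v {0}ᶜ := by
  intro z hz
  have hp : 0 < ‖z‖ := norm_pos_iff.2 hz
  let f : ContDiffBump z := ⟨‖z‖ / 4, ‖z‖ / 2, by positivity, by linarith⟩
  have hθ : IsPlaneTest {0}ᶜ fun s => (f s : ℂ) := by
    refine ⟨ofRealCLM.contDiff.comp f.contDiff, f.hasCompactSupport.comp_left (g := ofReal) rfl,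
      fun s hs h0 => ?_⟩
    have h0 : s = 0 := h0
    have h1 : s ∈ tsupport f :=
      closure_mono (fun t (ht : (f t : ℂ) ≠ 0) (h0 : f t = 0) => ht (by simp [h0])) hs
    rw [f.tsupport_eq, Metric.mem_closedBall, h0, dist_zero_left] at h1
    have : f.rOut = ‖z‖ / 2 := rfl
    linarith
  refine ⟨Metric.closedBall z (‖z‖ / 4),
    mem_nhdsWithin_of_mem_nhds (Metric.closedBall_mem_nhds z (by positivity)), ?_⟩
  refine IntegrableOn.congr_fun (h _ hθ).integrableOn (fun s hs => ?_) measurableSet_closedBall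
  have : f s = 1 := f.one_of_mem_closedBall hs
  simp [this]

/-- If the coefficient `u` is a function of `z` alone and `∂u/∂z̄ = a` on the covering, then `u`
satisfies a Cauchy–Riemann equation on the punctured plane. -/
lemma exists_weakDbarOn_of_cover {u : ℂ → ℂ} {a : ℂ × ℂ → ℂ} (hu : MemLp u 2 volume)
    (ham : StronglyMeasurable a) (ha : LocallyIntegrableOn a coverDomain)
    (h : ∀ χ, IsTest χ → ∫ y, χ y * a y = -∫ y, u y.1 * dbarDir χ y (1, 0)) :
    ∃ v : ℂ → ℂ, Measurable v ∧ LocallyIntegrableOn v {0}ᶜ ∧ WeakDbarOn {0}ᶜ u v := by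
  choose η hη hη1 using exists_window
  -- The fibre average of `a` against the `j`-th window. Testing with `θ(z) η_j(s)` and `∫ η_j = 1`
  -- gives `∂u/∂z̄ = w j` on the cone.
  let w : Bool × Bool → ℂ → ℂ := fun j z => ∫ s, η j s * a (z, s)
  have hwm : ∀ j, Measurable (w j) := fun j => by
    have : StronglyMeasurable fun y : ℂ × ℂ => η j y.2 * a y :=
      ((hη j).1.continuous.stronglyMeasurable.comp_measurable measurable_snd).mul ham
    exact this.integral_prod_right'.measurable
  have hint : ∀ j θ, IsPlaneTest (cone j) θ →
      Integrable fun y : ℂ × ℂ => θ y.1 * η j y.2 * a y := fun j θ hθ => by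
    have ht := isTest_mul hθ (hη j)
    exact integrable_mul_of_integrableOn_tsupport ht.1.continuous ht.2.1
      (ha.integrableOn_compact_subset ht.2.2 ht.2.1)
  have hw1 : ∀ j θ, IsPlaneTest (cone j) θ → Integrable fun z => θ z * w j z := fun j θ hθ => by
    have := hint j θ hθ
    rw [Measure.volume_eq_prod] at this
    refine this.integral_prod_left.congr (Eventually.of_forall fun z => ?_)
    simp_rw [mul_assoc, integral_const_mul]
    rfl
  have hw2 : ∀ j, WeakDbarOn (cone j) u (w j) := fun j θ hθ => by
    have h1 := h _ (isTest_mul hθ (hη j))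
    simp_rw [dbarDir_mul_fst hθ.1 (hη j).1, ← mul_assoc] at h1
    rw [Measure.volume_eq_prod, integral_prod_mul (fun z => u z * dbar θ z) (η j), hη1,
      mul_one, integral_prod _ (by simpa [Measure.volume_eq_prod] using hint j θ hθ)] at h1
    rw [← h1]
    simp_rw [mul_assoc, integral_const_mul]
    rfl
  refine ⟨fun z => ∑ j, coneWeight j z * w j z, Finset.measurable_sum _ fun j _ =>
    (measurable_coneWeight j).mul (hwm j), ?_, weakDbarOn_of_cone hu hw1 hw2⟩
  refine locallyIntegrableOn_of_mul_test fun θ hθ => ?_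
  have : Integrable fun z => ∑ j, θ z * coneWeight j z * w j z :=
    integrable_finsetSum _ fun j _ => hw1 j _ (isPlaneTest_mul_coneWeight hθ j)
  refine this.congr (Eventually.of_forall fun z => ?_)
  simp only [Finset.mul_sum, mul_assoc]

/-- The right-hand side of the Cauchy–Riemann equation on the covering is determined by the
solution on the punctured plane. -/
lemma ae_eq_of_weakDbarOn {u v : ℂ → ℂ} {a : ℂ × ℂ → ℂ} {b : ℂ} (hu : LocallyIntegrableOn u {0}ᶜ)
    (hv : LocallyIntegrableOn v {0}ᶜ) (huv : WeakDbarOn {0}ᶜ u v)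
    (ha : LocallyIntegrableOn a coverDomain)
    (h : ∀ χ, IsTest χ → ∫ y, χ y * a y = -(b * ∫ y, u y.1 * dbarDir χ y (1, 0))) :
    ∀ᵐ y, y ∈ coverDomain → a y = b * v y.1 := by
  have hv' := locallyIntegrableOn_comp_fst hv
  have hbv : LocallyIntegrableOn (fun y : ℂ × ℂ => b * v y.1) coverDomain := hv'.smul b
  have key := isOpen_coverDomain.ae_eq_zero_of_integral_contDiff_smul_eq_zero (ha.sub hbv) ?_
  · filter_upwards [key] with y hy hyc
    exact sub_eq_zero.1 (hy hyc)
  · intro g hg hgc hgs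
    have hχ : IsTest fun y => (g y : ℂ) := by
      refine ⟨ofRealCLM.contDiff.comp hg, hgc.comp_left (g := ofReal) rfl, Set.Subset.trans ?_ hgs⟩
      exact closure_mono fun s hs h0 => hs (by simp [h0])
    have i1 := integrable_mul_of_integrableOn_tsupport hχ.1.continuous hχ.2.1
      (ha.integrableOn_compact_subset hχ.2.2 hχ.2.1)
    have i2 := integrable_mul_of_integrableOn_tsupport hχ.1.continuous hχ.2.1
      (hbv.integrableOn_compact_subset hχ.2.2 hχ.2.1)
    simp only [Pi.sub_apply, real_smul, mul_sub]
    rw [integral_sub i1 i2, h _ hχ, sub_eq_zero]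
    simp_rw [mul_left_comm _ b]
    rw [integral_const_mul, huv.integral_cover hχ hu hv, mul_neg]

/-! ### Forms with coefficients that depend on `z` alone -/

/-- The `(2,0)`-covector `φ ∧ ψ`. -/
def phiPsi : formsOfType 2 0 :=
  ⟨wedge ![phi, psi], by
    intro c v
    simp [wedge_apply, Matrix.det_fin_two, phi, psi]
    ring⟩

/-- The factor `1 + |z|²` by which `dz` differs from `φ`. -/
def weight (z : ℂ) : ℂ := ((1 + ‖z‖ ^ 2 : ℝ) : ℂ)

lemma weight_ne_zero (z : ℂ) : weight z ≠ 0 := by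
  unfold weight; exact_mod_cast (by positivity)

lemma continuous_weight : Continuous weight := by unfold weight; fun_prop

lemma conj_weight (z : ℂ) : conj (weight z) = weight z := conj_ofReal _

lemma wedge_dz_psi (z : ℂ) : wedge ![dzAt z, psi] = weight z • (phiPsi.1 : _ [⋀^Fin 2]→ₗ[ℝ] ℂ) := by
  ext v
  simp [wedge_apply, Matrix.det_fin_two, phi, psi, phiPsi, dzAt, weight]
  ring

lemma wedge_dzBar_dz_psi (z : ℂ) : wedge ![conjCov (dzAt z), dzAt z, psi] =
    weight z ^ 2 • (phiBarPhiPsi.1 : _ [⋀^Fin 3]→ₗ[ℝ] ℂ) := by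
  ext v
  have := conj_weight z
  simp only [weight] at this
  simp [wedge_apply, Matrix.det_fin_three, phi, psi, phiBarPhiPsi, dzAt, weight, conjCov]
  ring

lemma phiPsi_apply (v : Fin (2 + 0) → ℂ × ℂ) :
    phiPsi.1 v = (v 0).1 * (v 1).2 - (v 0).2 * (v 1).1 := by
  change wedge ![phi, psi] v = _
  simp [wedge_apply, Matrix.det_fin_two, phi, psi]

lemma phiBarPhiPsi_apply (v : Fin (2 + 1) → ℂ × ℂ) :
    phiBarPhiPsi.1 v = conj (v 0).1 * (v 1).1 * (v 2).2 - conj (v 0).1 * (v 1).2 * (v 2).1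
      - (v 0).1 * conj (v 1).1 * (v 2).2 + (v 0).1 * (v 1).2 * conj (v 2).1
      + (v 0).2 * conj (v 1).1 * (v 2).1 - (v 0).2 * (v 1).1 * conj (v 2).1 := by
  change wedge ![conjCov phi, phi, psi] v = _
  simp [wedge_apply, Matrix.det_fin_three, phi, psi, conjCov]

lemma phiPsi_ne_zero : phiPsi ≠ 0 := by
  intro h
  have := congrArg (fun α : formsOfType 2 0 => α.1 ![((1 : ℂ), (0 : ℂ)), (0, 1)]) h
  simp [phiPsi_apply] at this

lemma phiBarPhiPsi_ne_zero : phiBarPhiPsi ≠ 0 := by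
  intro h
  have := congrArg (fun α : formsOfType 2 1 =>
    α.1 ![((1 : ℂ), (0 : ℂ)), ((I : ℂ), (0 : ℂ)), (0, 1)]) h
  simp [phiBarPhiPsi_apply] at this

lemma mem_zOnly20_iff {β : ℝ} {f : L2Form β 2 0} : f ∈ zOnly20 β ↔ ∃ u : ℂ → ℂ, Measurable u ∧
    ∀ᵐ x ∂domVolume β, f x = (u (coordZ x) * weight (coordZ x)) • phiPsi := by
  refine exists_congr fun u => and_congr_right fun _ => ?_
  refine eventually_congr (Eventually.of_forall fun x => ?_)
  rw [Subtype.ext_iff]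
  refine Eq.congr_right ?_
  rw [Submodule.coe_smul, mul_smul]
  exact congrArg _ (wedge_dz_psi _)

lemma mem_zOnly21_iff {β : ℝ} {g : L2Form β 2 1} : g ∈ zOnly21 β ↔ ∃ v : ℂ → ℂ, Measurable v ∧
    ∀ᵐ x ∂domVolume β, g x = (v (coordZ x) * weight (coordZ x) ^ 2) • phiBarPhiPsi := by
  refine exists_congr fun u => and_congr_right fun _ => ?_
  refine eventually_congr (Eventually.of_forall fun x => ?_)
  rw [Subtype.ext_iff]
  refine Eq.congr_right ?_
  rw [Submodule.coe_smul, mul_smul]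
  exact congrArg _ (wedge_dzBar_dz_psi _)

lemma memLp_smul_const_iff {p q : ℕ} {β : ℝ} {F : Surf β → ℂ} {Φ : formsOfType p q} (hΦ : Φ ≠ 0)
    (hF : Measurable F) :
    MemLp (fun x => F x • Φ) 2 (domVolume β) ↔ MemLp F 2 (domVolume β) := by
  have hp : 0 < ‖Φ‖ := norm_pos_iff.2 hΦ
  constructor
  · intro h
    refine h.of_le_mul (c := ‖Φ‖⁻¹) hF.aestronglyMeasurable (Eventually.of_forall fun x => ?_)
    rw [norm_smul, mul_comm ‖F x‖, inv_mul_cancel_left₀ hp.ne']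
  · intro h
    refine h.of_le_mul (c := ‖Φ‖) (hF.stronglyMeasurable.smul_const Φ).aestronglyMeasurable
      (Eventually.of_forall fun x => ?_)
    rw [norm_smul, mul_comm]

/-- The factor `1 + |z|²` from `dz` cancels the square root of the volume density. -/
lemma memLp_coeff20_iff {β : ℝ} (hβ : 0 < β) {u : ℂ → ℂ} (hu : Measurable u) :
    MemLp (fun x => (u (coordZ x) * weight (coordZ x)) • phiPsi) 2 (domVolume β) ↔
      MemLp u 2 volume := by
  have hm : Measurable fun z => u z * weight z := hu.mul continuous_weight.measurable
  refine ((memLp_smul_const_iff phiPsi_ne_zero (hm.comp (measurable_coordZ β))).trans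
    (memLp_comp_coordZ_iff hβ hm)).trans ?_
  refine memLp_congr_ae (Eventually.of_forall fun z => ?_)
  have := weight_ne_zero z
  beta_reduce
  rw [ofReal_inv, ← weight]
  field_simp

/-- `dz̄ ∧ dz` contributes two factors `1 + |z|²`, of which the volume density absorbs only one. -/
lemma memLp_coeff21_iff {β : ℝ} (hβ : 0 < β) {v : ℂ → ℂ} (hv : Measurable v) :
    MemLp (fun x => (v (coordZ x) * weight (coordZ x) ^ 2) • phiBarPhiPsi) 2 (domVolume β) ↔
      MemLp (fun z => ((1 + ‖z‖ ^ 2 : ℝ) : ℂ) * v z) 2 volume := by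
  have hm : Measurable fun z => v z * weight z ^ 2 := 
    hv.mul (continuous_weight.measurable.pow_const 2)
  refine ((memLp_smul_const_iff phiBarPhiPsi_ne_zero (hm.comp (measurable_coordZ β))).trans
    (memLp_comp_coordZ_iff hβ hm)).trans ?_
  refine memLp_congr_ae (Eventually.of_forall fun z => ?_)
  have := weight_ne_zero z
  beta_reduce
  rw [ofReal_inv, ← weight]
  field_simp

/-! ### Pull-backs -/

lemma pullback_coeff20 {β : ℝ} {f : Surf β → formsOfType 2 0} {u : ℂ → ℂ} {y : ℂ × ℂ}
    (h : f (cover β y) = (u y.1 * weight y.1) • phiPsi) (v : Fin (2 + 0) → ℂ × ℂ) :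
    pullback f y v = u y.1 * phiPsi.1 v := by
  have := weight_ne_zero y.1
  rw [pullback, h, Submodule.coe_smul, AlternatingMap.smul_apply, phiPsi_apply, phiPsi_apply,
    ← weight, smul_eq_mul]
  field_simp

lemma pullback_coeff21 {β : ℝ} {g : Surf β → formsOfType 2 1} {w : ℂ} {y : ℂ × ℂ}
    (h : g (cover β y) = (w * weight y.1 ^ 2) • phiBarPhiPsi) (v : Fin (2 + 1) → ℂ × ℂ) :
    pullback g y v = w * phiBarPhiPsi.1 v := by
  have := weight_ne_zero y.1
  rw [pullback, h, Submodule.coe_smul, AlternatingMap.smul_apply, phiBarPhiPsi_apply,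
    phiBarPhiPsi_apply, ← weight, smul_eq_mul]
  simp only [map_div₀, conj_weight]
  field_simp

/-- The covector `ψ̄ ∧ φ ∧ ψ`. -/
def psiBarPhiPsi : (ℂ × ℂ) [⋀^Fin 3]→ₗ[ℝ] ℂ := wedge ![conjCov psi, phi, psi]

/-- By conjugate linearity of `dbarDir`, the sum evaluates `∂̄χ ∧ φ ∧ ψ` with `∂̄χ = χ_z̄ φ̄ + χ_s̄
ψ̄`. -/
lemma sum_dbarDir_mul_phiPsi (χ : ℂ × ℂ → ℂ) (y : ℂ × ℂ) (v : Fin (2 + 0 + 1) → ℂ × ℂ) :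
    ∑ i : Fin (2 + 0 + 1), (-1) ^ (i : ℕ) * dbarDir χ y (v i) *
      phiPsi.1 (fun j => v (i.succAbove j)) =
    phiBarPhiPsi.1 v * dbarDir χ y (1, 0) + psiBarPhiPsi v * dbarDir χ y (0, 1) := by
  have e : psiBarPhiPsi v = conj (v 0).2 * (v 1).1 * (v 2).2 - conj (v 0).2 * (v 1).2 * (v 2).1
      - (v 0).1 * conj (v 1).2 * (v 2).2 + (v 0).1 * (v 1).2 * conj (v 2).2
      + (v 0).2 * conj (v 1).2 * (v 2).1 - (v 0).2 * (v 1).1 * conj (v 2).2 := by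
    simp [psiBarPhiPsi, wedge_apply, Matrix.det_fin_three, phi, psi, conjCov]
  have e2 : phiBarPhiPsi.1 v = _ := phiBarPhiPsi_apply v
  rw [e, e2]
  have h0 : ∀ w : Fin (2 + 0 + 1) → ℂ × ℂ, ∑ i : Fin (2 + 0 + 1), (-1) ^ (i : ℕ) *
      dbarDir χ y (w i) * phiPsi.1 (fun j => w (i.succAbove j)) =
      dbarDir χ y (w 0) * ((w 1).1 * (w 2).2 - (w 1).2 * (w 2).1) -
      dbarDir χ y (w 1) * ((w 0).1 * (w 2).2 - (w 0).2 * (w 2).1) +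
      dbarDir χ y (w 2) * ((w 0).1 * (w 1).2 - (w 0).2 * (w 1).1) := by
    intro w
    rw [Fin.sum_univ_three]
    simp only [phiPsi_apply]
    have s0 : (0 : Fin 3).succAbove (0 : Fin 2) = 1 := rfl
    have s1 : (0 : Fin 3).succAbove (1 : Fin 2) = 2 := rfl
    have s2 : (1 : Fin 3).succAbove (0 : Fin 2) = 0 := rfl
    have s3 : (1 : Fin 3).succAbove (1 : Fin 2) = 2 := rfl
    have s4 : (2 : Fin 3).succAbove (0 : Fin 2) = 0 := rfl
    have s5 : (2 : Fin 3).succAbove (1 : Fin 2) = 1 := rfl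
    simp only [Nat.add_zero, s0, s1, s2, s3, s4, s5]
    simp
    ring
  rw [h0, dbarDir_eq χ y (v 0), dbarDir_eq χ y (v 1), dbarDir_eq χ y (v 2)]
  ring

lemma dbarDir_eq_zero_of_notMem {χ : ℂ × ℂ → ℂ} (hχ : IsTest χ) {y : ℂ × ℂ}
    (hy : y ∉ coverDomain) (v : ℂ × ℂ) : dbarDir χ y v = 0 := by
  by_contra h
  exact hy (hχ.2.2 (tsupport_dbarDir_subset χ v (subset_tsupport _ h)))

lemma IsTest.eq_zero_of_notMem {χ : ℂ × ℂ → ℂ} (hχ : IsTest χ) {y : ℂ × ℂ}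
    (hy : y ∉ coverDomain) : χ y = 0 := by
  by_contra h
  exact hy (hχ.2.2 (subset_tsupport _ h))

lemma integrable_mul_dbarDir {χ : ℂ × ℂ → ℂ} {u : ℂ → ℂ} (hχ : IsTest χ)
    (hu : LocallyIntegrableOn u {0}ᶜ) (v : ℂ × ℂ) :
    Integrable fun y : ℂ × ℂ => u y.1 * dbarDir χ y v := by
  simp_rw [mul_comm (u _)]
  refine integrable_mul_of_integrableOn_tsupport (continuous_dbarDir hχ.1 _)
    (hasCompactSupport_dbarDir hχ.2.1 _) ?_
  exact (locallyIntegrableOn_comp_fst hu).integrableOn_compact_subset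
    ((tsupport_dbarDir_subset χ _).trans hχ.2.2) (hasCompactSupport_dbarDir hχ.2.1 _)

/-- The distributional `∂̄` of a form `u dz ∧ ψ` with a coefficient that depends on `z` alone. -/
lemma integral_sum_dbarDir_pullback {β : ℝ} (hβ : 0 < β) {f : L2Form β 2 0} {u : ℂ → ℂ}
    (hu : LocallyIntegrableOn u {0}ᶜ)
    (hf : ∀ᵐ x ∂domVolume β, f x = (u (coordZ x) * weight (coordZ x)) • phiPsi)
    {χ : ℂ × ℂ → ℂ} (hχ : IsTest χ) (v : Fin (2 + 0 + 1) → ℂ × ℂ) :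
    ∫ y, ∑ i : Fin (2 + 0 + 1), (-1) ^ (i : ℕ) * dbarDir χ y (v i) *
      pullback f y (fun j => v (i.succAbove j)) =
    phiBarPhiPsi.1 v * ∫ y, u y.1 * dbarDir χ y (1, 0) := by
  have e : ∀ᵐ y : ℂ × ℂ, ∑ i : Fin (2 + 0 + 1), (-1) ^ (i : ℕ) * dbarDir χ y (v i) *
      pullback f y (fun j => v (i.succAbove j)) =
      phiBarPhiPsi.1 v * (u y.1 * dbarDir χ y (1, 0)) +
        psiBarPhiPsi v * (u y.1 * dbarDir χ y (0, 1)) := by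
    filter_upwards [ae_coverDomain_of_ae hβ hf] with y hy
    by_cases hyc : y ∈ coverDomain
    · have h1 := fun w => pullback_coeff20 (u := u) (hy hyc) w
      simp_rw [h1]
      have := sum_dbarDir_mul_phiPsi χ y v
      calc _ = u y.1 * ∑ i : Fin (2 + 0 + 1), (-1) ^ (i : ℕ) * dbarDir χ y (v i) *
            phiPsi.1 (fun j => v (i.succAbove j)) := by
              rw [Finset.mul_sum]
              exact Finset.sum_congr rfl fun i _ => by ring
        _ = _ := by rw [this]; ring
    · simp [dbarDir_eq_zero_of_notMem hχ hyc]
  rw [integral_congr_ae e, integral_add ((integrable_mul_dbarDir hχ hu _).const_mul _)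
    ((integrable_mul_dbarDir hχ hu _).const_mul _), integral_const_mul, integral_const_mul,
    integral_mul_dbarDir_snd hχ hu, mul_zero, add_zero]

/-- A solution of the Cauchy–Riemann equation on the punctured plane gives a solution of the
`∂̄`-equation on the domain. -/
lemma isWeakDbar_of_weakDbarOn {β : ℝ} (hβ : 0 < β) {f : L2Form β 2 0} {g : L2Form β 2 1}
    {u v : ℂ → ℂ} (hu : LocallyIntegrableOn u {0}ᶜ) (hv : LocallyIntegrableOn v {0}ᶜ)
    (hf : ∀ᵐ x ∂domVolume β, f x = (u (coordZ x) * weight (coordZ x)) • phiPsi)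
    (hg : ∀ᵐ x ∂domVolume β, g x = (v (coordZ x) * weight (coordZ x) ^ 2) • phiBarPhiPsi)
    (h : WeakDbarOn {0}ᶜ u v) : IsWeakDbar f g := by
  intro χ hχ V
  refine Eq.trans ?_ (congrArg Neg.neg (integral_sum_dbarDir_pullback hβ hu hf hχ V).symm)
  rw [← mul_neg, ← h.integral_cover hχ hu hv, ← integral_const_mul]
  refine integral_congr_ae ?_
  filter_upwards [ae_coverDomain_of_ae hβ hg] with y hy
  by_cases hyc : y ∈ coverDomain
  · have h1 : pullback g y V = v y.1 * phiBarPhiPsi.1 V := pullback_coeff21 (hy hyc) V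
    refine (congrArg (χ y * ·) h1).trans ?_
    ring
  · simp [hχ.eq_zero_of_notMem hyc]

/-! ### Coefficients of forms -/

/-- A single term of the sum of squares defining the norm; it makes frame coefficients continuous,
so they inherit integrability and measurability. -/
lemma norm_apply_frame_le (p q : ℕ) (e : Fin (p + q) → Fin 2 ⊕ Fin 2) (α : formsOfType p q) :
    ‖α.1 fun i => realFrame (e i)‖ ≤ √(2 ^ (p + q) * (p + q).factorial) * ‖α‖ := by
  have h1 : ‖α‖ ^ 2 = (2 ^ (p + q) * (p + q).factorial : ℝ)⁻¹ *
      ∑ e : Fin (p + q) → Fin 2 ⊕ Fin 2, ‖α.1 fun i => realFrame (e i)‖ ^ 2 := by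
    have h2 : ⟪α, α⟫_ℂ = formInner p q α α := rfl
    have h3 := inner_self_eq_norm_sq (𝕜 := ℂ) α
    rw [h2, formInner_self] at h3
    rw [← h3]
    exact ofReal_re _
  have hc : (0 : ℝ) < 2 ^ (p + q) * (p + q).factorial := by positivity
  have h4 : ‖α.1 fun i => realFrame (e i)‖ ^ 2 ≤ 2 ^ (p + q) * (p + q).factorial * ‖α‖ ^ 2 := by
    rw [h1, mul_inv_cancel_left₀ hc.ne']
    exact Finset.single_le_sum (f := fun e : Fin (p + q) → Fin 2 ⊕ Fin 2 =>
      ‖α.1 fun i => realFrame (e i)‖ ^ 2) (fun _ _ => by positivity) (Finset.mem_univ e)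
  refine (sq_le_sq₀ (norm_nonneg _) (by positivity)).1 ?_
  rwa [mul_pow, Real.sq_sqrt hc.le]

/-- The coefficient of a form with respect to the real frame. -/
def frameCoeff (p q : ℕ) (e : Fin (p + q) → Fin 2 ⊕ Fin 2) : formsOfType p q →L[ℂ] ℂ :=
  LinearMap.mkContinuous
    { toFun := fun α => α.1 fun i => realFrame (e i)
      map_add' := fun _ _ => rfl
      map_smul' := fun _ _ => rfl }
    (√(2 ^ (p + q) * (p + q).factorial)) (norm_apply_frame_le p q e)

lemma frameCoeff_apply (p q : ℕ) (e : Fin (p + q) → Fin 2 ⊕ Fin 2) (α : formsOfType p q) :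
    frameCoeff p q e α = α.1 fun i => realFrame (e i) := rfl

/-- The factor by which a frame vector is scaled under pull-back to the covering. -/
def frameScale (a : Fin 2 ⊕ Fin 2) (z : ℂ) : ℝ := Sum.elim (fun _ => (1 + ‖z‖ ^ 2)⁻¹) (fun _ => 1) a

lemma frameScale_pos (a : Fin 2 ⊕ Fin 2) (z : ℂ) : 0 < frameScale a z := by
  rcases a with a | a <;> simp only [frameScale, Sum.elim_inl, Sum.elim_inr] <;> positivity

lemma continuous_frameScale (a : Fin 2 ⊕ Fin 2) : Continuous (frameScale a) := by
  rcases a with a | a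
  · exact Continuous.inv₀ (by fun_prop) fun z => by positivity
  · exact continuous_const

lemma scale_realFrame (a : Fin 2 ⊕ Fin 2) (z : ℂ) :
    ((realFrame a).1 / ((1 + ‖z‖ ^ 2 : ℝ) : ℂ), (realFrame a).2) =
      frameScale a z • realFrame a := by
  rcases a with a | a
  · refine Prod.ext ?_ ?_ <;>
      simp [realFrame, frameScale, div_eq_mul_inv, mul_comm]
  · refine Prod.ext ?_ ?_ <;> simp [realFrame, frameScale]

lemma pullback_frame {β : ℝ} {p q : ℕ} (f : Surf β → formsOfType p q) (y : ℂ × ℂ)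
    (e : Fin (p + q) → Fin 2 ⊕ Fin 2) :
    pullback f y (fun i => realFrame (e i)) =
      ((∏ i, frameScale (e i) y.1 : ℝ) : ℂ) * frameCoeff p q e (f (cover β y)) := by
  simp only [pullback, scale_realFrame]
  rw [AlternatingMap.map_smul_univ, real_smul, frameCoeff_apply]

lemma continuous_prod_frameScale {k : ℕ} (e : Fin k → Fin 2 ⊕ Fin 2) :
    Continuous fun y : ℂ × ℂ => ((∏ i, frameScale (e i) y.1 : ℝ) : ℂ) :=
  continuous_ofReal.comp (continuous_finsetProd _ fun i _ =>
    (continuous_frameScale (e i)).comp continuous_fst)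

lemma locallyIntegrableOn_pullback_frame {β : ℝ} (hβ : 0 < β) {p q : ℕ} (f : L2Form β p q)
    (e : Fin (p + q) → Fin 2 ⊕ Fin 2) :
    LocallyIntegrableOn (fun y => pullback f y fun i => realFrame (e i)) coverDomain := by
  simp_rw [pullback_frame]
  refine LocallyIntegrableOn.continuousOn_mul ?_ (continuous_prod_frameScale e).continuousOn
    isOpen_coverDomain.isLocallyClosed
  exact locallyIntegrableOn_comp_cover hβ (F := fun x => frameCoeff p q e (f x))
    ((frameCoeff p q e).integrable_comp ((Lp.memLp f).integrable one_le_two))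

lemma stronglyMeasurable_pullback_frame {β : ℝ} {p q : ℕ} (f : L2Form β p q)
    (e : Fin (p + q) → Fin 2 ⊕ Fin 2) :
    StronglyMeasurable fun y => pullback f y fun i => realFrame (e i) := by
  simp_rw [pullback_frame]
  refine (continuous_prod_frameScale e).stronglyMeasurable.mul ?_
  exact (frameCoeff p q e).continuous.comp_stronglyMeasurable
    ((Lp.stronglyMeasurable f).comp_measurable (continuous_cover β).measurable)

/-- If the distributional `∂̄` of a form `u dz ∧ ψ` with coefficient depending on `z` alone is
square integrable, then it is of the form `v dz̄ ∧ dz ∧ ψ` with `∂u/∂z̄ = v`. -/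
lemma IsWeakDbar.exists_coeff {β : ℝ} (hβ : 0 < β) {f : L2Form β 2 0} {g : L2Form β 2 1}
    {u : ℂ → ℂ} (hu : MemLp u 2 volume)
    (hf : ∀ᵐ x ∂domVolume β, f x = (u (coordZ x) * weight (coordZ x)) • phiPsi)
    (h : IsWeakDbar f g) : ∃ v : ℂ → ℂ, Measurable v ∧ WeakDbarOn {0}ᶜ u v ∧
      ∀ᵐ x ∂domVolume β, g x = (v (coordZ x) * weight (coordZ x) ^ 2) • phiBarPhiPsi := by
  have hul : LocallyIntegrableOn u {0}ᶜ :=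
    (hu.locallyIntegrable one_le_two).locallyIntegrableOn _
  have key : ∀ (e : Fin (2 + 1) → Fin 2 ⊕ Fin 2) χ, IsTest χ →
      ∫ y, χ y * pullback g y (fun i => realFrame (e i)) =
        -(phiBarPhiPsi.1 (fun i => realFrame (e i)) * ∫ y, u y.1 * dbarDir χ y (1, 0)) :=
    fun e χ hχ => (h χ hχ fun i => realFrame (e i)).trans
      (congrArg Neg.neg (integral_sum_dbarDir_pullback hβ hul hf hχ _))
  -- The frame triple `(1,0), (i,0), (0,1)`, on which `φ̄ ∧ φ ∧ ψ` takes the nonzero value `2i`;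
  -- this component of `g` produces `v`.
  let e₀ : Fin (2 + 1) → Fin 2 ⊕ Fin 2 := ![Sum.inl 0, Sum.inl 1, Sum.inr 0]
  have he₀ : phiBarPhiPsi.1 (fun i => realFrame (e₀ i)) = 2 * I := by
    rw [phiBarPhiPsi_apply]
    simp [e₀, realFrame]
    ring
  obtain ⟨v, hv, hvl, hvw⟩ := exists_weakDbarOn_of_cover (u := u)
    (a := fun y => (2 * I)⁻¹ * pullback g y fun i => realFrame (e₀ i)) hu
    (stronglyMeasurable_const.mul (stronglyMeasurable_pullback_frame g e₀))
    ((locallyIntegrableOn_pullback_frame hβ g e₀).smul (2 * I)⁻¹) fun χ hχ => by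
      have := key e₀ χ hχ
      simp_rw [mul_left_comm _ (2 * I)⁻¹]
      rw [integral_const_mul, this, he₀, mul_neg, inv_mul_cancel_left₀ (by simp)]
  refine ⟨v, hv, hvw, ?_⟩
  -- Every frame component of `g` is now determined by `v`, including those where `φ̄ ∧ φ ∧ ψ`
  -- vanishes; so `g` has no other part.
  have hae : ∀ᵐ y : ℂ × ℂ, ∀ e : Fin (2 + 1) → Fin 2 ⊕ Fin 2, y ∈ coverDomain →
      pullback g y (fun i => realFrame (e i)) =
        phiBarPhiPsi.1 (fun i => realFrame (e i)) * v y.1 :=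
    ae_all_iff.2 fun e => ae_eq_of_weakDbarOn hul hvl hvw
      (locallyIntegrableOn_pullback_frame hβ g e) (key e)
  refine ae_domVolume_of_ae ?_ ?_
  · refine StronglyMeasurable.measurableSet_eq_fun (Lp.stronglyMeasurable g)
      (StronglyMeasurable.smul_const (Measurable.stronglyMeasurable ?_) _)
    exact (hv.comp (measurable_coordZ β)).mul
      ((continuous_weight.measurable.comp (measurable_coordZ β)).pow_const 2)
  · filter_upwards [hae] with y hy hyc
    refine Subtype.ext (Module.Basis.ext_alternating realFrame fun e _ => ?_)
    have h1 := hy e hyc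
    -- A form with the desired value at this point; its pull-back has the same positive scale
    -- factors as that of `g`, and these cancel.
    let G : Surf β → formsOfType 2 1 := fun _ => (v y.1 * weight y.1 ^ 2) • phiBarPhiPsi
    have h2 : pullback G y (fun i => realFrame (e i)) = _ := pullback_coeff21 (y := y) rfl _
    rw [mul_comm, ← h2, pullback_frame, pullback_frame] at h1
    refine mul_left_cancel₀ ?_ h1
    rw [ofReal_ne_zero]
    exact (Finset.prod_pos fun i _ => frameScale_pos _ _).ne'

/-! ### Orthogonality and closedness -/

lemma coeFn_gForm (β : ℝ) : ∀ᵐ x ∂domVolume β, gForm β x = phiBarPhiPsi :=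
  MemLp.coeFn_toLp _

lemma gForm_mem_zOnly21 (β : ℝ) : gForm β ∈ zOnly21 β := by
  refine mem_zOnly21_iff.2 ⟨fun z => (weight z ^ 2)⁻¹,
    (continuous_weight.measurable.pow_const 2).inv, ?_⟩
  filter_upwards [coeFn_gForm β] with x hx
  rw [hx, inv_mul_cancel₀ (pow_ne_zero 2 (weight_ne_zero _)), one_smul]

/-- The volume density cancels `(1 + |z|²)²`, leaving `∫ v` times the nonzero fibre volume and `‖φ̄
∧ φ ∧ ψ‖²`. -/
lemma inner_gForm_eq_zero_iff {β : ℝ} (hβ : 0 < β) {g : L2Form β 2 1} {v : ℂ → ℂ}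
    (hv : Measurable v)
    (hg : ∀ᵐ x ∂domVolume β, g x = (v (coordZ x) * weight (coordZ x) ^ 2) • phiBarPhiPsi) :
    ⟪gForm β, g⟫_ℂ = 0 ↔ ∫ z, v z = 0 := by
  have e : ⟪gForm β, g⟫_ℂ = ∫ x, (v (coordZ x) * weight (coordZ x) ^ 2) *
      ⟪phiBarPhiPsi, phiBarPhiPsi⟫_ℂ ∂domVolume β := by
    rw [L2.inner_def]
    refine integral_congr_ae ?_
    filter_upwards [hg, coeFn_gForm β] with x h1 h2
    rw [h1, h2, inner_smul_right]
  have hm : Measurable fun z => v z * weight z ^ 2 :=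
    hv.mul (continuous_weight.measurable.pow_const 2)
  have hd : ∀ z, density z • (v z * weight z ^ 2) = v z := fun z => by
    have := weight_ne_zero z
    have e : (density z : ℂ) = (weight z ^ 2)⁻¹ := by
      rw [density, weight]; push_cast; rfl
    rw [real_smul, e]
    field_simp
  rw [e, integral_mul_const, integral_comp_coordZ β hm, mul_eq_zero]
  simp_rw [hd]
  rw [smul_eq_zero, ENNReal.toReal_eq_zero_iff]
  have hne : ⟪phiBarPhiPsi, phiBarPhiPsi⟫_ℂ ≠ 0 := inner_self_ne_zero.2 phiBarPhiPsi_ne_zero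
  simp only [fiberVolume_ne_zero hβ, fiberVolume_ne_top, hne, false_or, or_false]

/-- A subsequence converges almost everywhere, and pairing with `φ̄ ∧ φ ∧ ψ` recovers the limit of
the coefficients. `limUnder` makes that limit a measurable function of `z` everywhere, with
arbitrary values where there is no convergence. -/
lemma isClosed_zOnly21 (β : ℝ) : IsClosed (zOnly21 β : Set (L2Form β 2 1)) := by
  refine IsSeqClosed.isClosed fun g g₀ hg hlim => ?_
  choose v hv hgv using fun n => mem_zOnly21_iff.1 (hg n)
  obtain ⟨ns, -, hns⟩ := (tendstoInMeasure_of_tendsto_Lp hlim).exists_seq_tendsto_ae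
  let F : ℕ → ℂ → ℂ := fun n z => v (ns n) z * weight z ^ 2
  have hF : ∀ n, Measurable (F n) := fun n =>
    (hv _).mul (continuous_weight.measurable.pow_const 2)
  let L : ℂ → ℂ := fun z => limUnder atTop fun n => F n z
  have hL : Measurable L :=
    (StronglyMeasurable.limUnder fun n => (hF n).stronglyMeasurable).measurable
  refine mem_zOnly21_iff.2 ⟨fun z => L z / weight z ^ 2,
    hL.div (continuous_weight.measurable.pow_const 2), ?_⟩
  filter_upwards [hns, ae_all_iff.2 fun n => hgv (ns n)] with x hx hxv
  have h1 : Tendsto (fun n => F n (coordZ x) • phiBarPhiPsi) atTop (𝓝 (g₀ x)) :=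
    hx.congr fun n => hxv n
  have hne : ⟪phiBarPhiPsi, phiBarPhiPsi⟫_ℂ ≠ 0 := inner_self_ne_zero.2 phiBarPhiPsi_ne_zero
  have h2 : Tendsto (fun n => F n (coordZ x)) atTop
      (𝓝 (⟪phiBarPhiPsi, g₀ x⟫_ℂ / ⟪phiBarPhiPsi, phiBarPhiPsi⟫_ℂ)) := by
    have := ((tendsto_const_nhds (x := phiBarPhiPsi)).inner h1).div_const
      ⟪phiBarPhiPsi, phiBarPhiPsi⟫_ℂ
    refine this.congr fun n => ?_
    rw [inner_smul_right, mul_div_cancel_right₀ _ hne]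
  have h3 : Tendsto (fun n => F n (coordZ x)) atTop (𝓝 (L (coordZ x))) := by
    have e : L (coordZ x) = _ := h2.limUnder_eq
    rwa [e]
  rw [div_mul_cancel₀ _ (pow_ne_zero 2 (weight_ne_zero _))]
  exact tendsto_nhds_unique h1 (h3.smul_const _)

theorem dbarRangeZOnly_eq {β : ℝ} (hβ : 0 < β) :
    dbarRangeZOnly β = {g | g ∈ zOnly21 β ∧ ⟪gForm β, g⟫_ℂ = 0} := by
  ext g
  constructor
  · rintro ⟨f, hf, hfg⟩
    obtain ⟨u, hu, hfu⟩ := mem_zOnly20_iff.1 hf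
    have hu2 : MemLp u 2 volume :=
      (memLp_coeff20_iff hβ hu).1 ((memLp_congr_ae hfu).1 (Lp.memLp f))
    obtain ⟨v, hv, huv, hgv⟩ := IsWeakDbar.exists_coeff hβ hu2 hfu hfg
    have hv2 := (memLp_coeff21_iff hβ hv).1 ((memLp_congr_ae hgv).1 (Lp.memLp g))
    exact ⟨mem_zOnly21_iff.2 ⟨v, hv, hgv⟩, (inner_gForm_eq_zero_iff hβ hv hgv).2
      (integral_eq_zero_of_weakDbarOn hu2 (integrable_of_weighted hv2) huv)⟩
  · rintro ⟨hg, h0⟩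
    obtain ⟨v, hv, hgv⟩ := mem_zOnly21_iff.1 hg
    have hv2 := (memLp_coeff21_iff hβ hv).1 ((memLp_congr_ae hgv).1 (Lp.memLp g))
    obtain ⟨u, hu, hu2, huv⟩ :=
      exists_weakDbar_eq hv2 ((inner_gForm_eq_zero_iff hβ hv hgv).1 h0)
    have hf := (memLp_coeff20_iff hβ hu).2 hu2
    refine ⟨hf.toLp _, mem_zOnly20_iff.2 ⟨u, hu, hf.coeFn_toLp⟩, ?_⟩
    -- The solution on the whole plane is restricted to the punctured plane.
    exact isWeakDbar_of_weakDbarOn hβ ((hu2.locallyIntegrable one_le_two).locallyIntegrableOn _)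
      ((integrable_of_weighted hv2).locallyIntegrable.locallyIntegrableOn _) hf.coeFn_toLp hgv
      fun θ hθ => huv θ ⟨hθ.1, hθ.2.1, Set.subset_univ _⟩

end

end OhsawaDomain

theorem proposition5p3 (β : ℝ) (hβ : 0 < β) :
    IsClosed (OhsawaDomain.dbarRangeZOnly β) ∧
    IsClosed (OhsawaDomain.zOnly21 β : Set (OhsawaDomain.L2Form β 2 1)) ∧
    OhsawaDomain.gForm β ∈ OhsawaDomain.zOnly21 β ∧
    OhsawaDomain.dbarRangeZOnly β =
      {g | g ∈ OhsawaDomain.zOnly21 β ∧ ⟪OhsawaDomain.gForm β, g⟫_ℂ = 0} := by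
  refine ⟨?_, OhsawaDomain.isClosed_zOnly21 β, OhsawaDomain.gForm_mem_zOnly21 β,
    OhsawaDomain.dbarRangeZOnly_eq hβ⟩
  -- Closedness of the range is read off from its description as an orthogonal complement.
  rw [OhsawaDomain.dbarRangeZOnly_eq hβ]
  exact (OhsawaDomain.isClosed_zOnly21 β).and
    (isClosed_eq (continuous_const.inner continuous_id) continuous_const)
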